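/- Let $E$ be a compact Polish space, and let $\mathcal K(E)$ be the space of all compact subsets of $E$ (including $\emptyset$) with the Vietoris topology. Let $I\subseteq\mathcal K(E)$ be an ideal of compact sets, i.e. a nonempty family closed under taking compact subsets and finite unions. Suppose that $I$ is a $G_\delta$ subset of $\mathcal K(E)$ and has property $(*)$: for every sequence $(K_n)_{n\in\mathbb N}$ of members of $I$ there is a $G_\delta$ set $G\subseteq E$ such that $\bigcup_n K_n\subseteq G$ and every compact subset of $G$ belongs to $I$. For $A\subseteq E$ write $A^*=\{K\in\mathcal K(E): K\cap A\neq\emptyset\}$, and say that $A^*$ is meager in $\mathcal F\subseteq\mathcal K(E)$ if $A^*\cap\mathcal F$ is a meager subset of the subspace $\mathcal F$. Then there exists a compact set $\mathcal F\subseteq\mathcal K(E)$ such that for every $G_\delta$ set $G\subseteq E$, $$G\subseteq\bigcup_{n\in\mathbb N}K_n\text{ for some sequence }(K_n)_{n\in\mathbb N}\text{ of members of }I\iff G^*\text{ is meager in }\mathcal F.$$ Further, if every member of $I$ is meager in $E$, then there exists a compact $\mathcal F$ with this same property that is also upward closed, i.e. contains every compact superset of each of its members. -/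

import Mathlib

open Set TopologicalSpace

/-- An ideal of compact sets: a nonempty family of compact subsets of `E`, closed under taking
compact subsets and finite unions. -/
structure IsCompactIdeal {E : Type*} [TopologicalSpace E] (I : Set (Compacts E)) : Prop where
  nonempty : I.Nonempty
  mem_of_subset : ∀ K ∈ I, ∀ L : Compacts E, (L : Set E) ⊆ K → L ∈ I
  sup_mem : ∀ K ∈ I, ∀ L ∈ I, K ⊔ L ∈ I

/-- Property `(*)`: for any sequence `K₀, K₁, …` in `I` there is a `G_δ` set `G` containing
all the `Kₙ`, all of whose compact subsets belong to `I`. -/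
def HasPropertyStar {E : Type*} [TopologicalSpace E] (I : Set (Compacts E)) : Prop :=
  ∀ K : ℕ → Compacts E, (∀ n, K n ∈ I) →
    ∃ G : Set E, IsGδ G ∧ (⋃ n, (K n : Set E)) ⊆ G ∧
      ∀ L : Compacts E, (L : Set E) ⊆ G → L ∈ I

/-- `A* = {K : K ∩ A ≠ ∅}`, the set of compact sets that intersect `A`. -/
def hitSet {E : Type*} [TopologicalSpace E] (A : Set E) : Set (Compacts E) :=
  {K | ((K : Set E) ∩ A).Nonempty}

/-- `𝒜` is meager in `𝓕`: `𝒜 ∩ 𝓕` is meager in the subspace topology of `𝓕`. -/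
def IsMeagerIn {X : Type*} [TopologicalSpace X] (𝒜 𝓕 : Set X) : Prop :=
  IsMeagre ((↑) ⁻¹' 𝒜 : Set 𝓕)

/-- `A` is covered by countably many members of `I`. -/
def IsCountablyCovered {E : Type*} [TopologicalSpace E] (I : Set (Compacts E)) (A : Set E) :
    Prop :=
  ∃ K : ℕ → Compacts E, (∀ n, K n ∈ I) ∧ A ⊆ ⋃ n, (K n : Set E)

/-- `𝓕` is upward closed: it contains all compact supersets of its members. -/
def IsUpwardClosed {E : Type*} [TopologicalSpace E] (𝓕 : Set (Compacts E)) : Prop :=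
  ∀ K ∈ 𝓕, ∀ L : Compacts E, (K : Set E) ⊆ L → L ∈ 𝓕

/-!
Call a family `C` of compact sets avoidable if no countable union of members of `I` meets all the
compact sets that are transversal to `C`. By property `(*)` and the Baire category theorem in
`Compacts E`, a nonempty closed family of compact sets having no avoidable nonempty relatively open
subfamily contains a member of `I`. So every closed family disjoint from `I` is covered by countably
many avoidable ones, and since `I` is a `G_δ` set, so is its complement.

Suppose first that the members of `I` are meager, and let `T` be the closure of
`{x | {x} ∈ I}`. If `T` is not countably covered, then `𝓕` is built so that, whenever compact
subsets of a `D ∈ 𝓕` witness that `C` is avoidable, there are members of `𝓕` arbitrarily near `D`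
around which all the members of `𝓕` are transversal to `C`.
Being transversal to `C` is imposed on a member only when it misses a gate, a small
neighbourhood of a finite net of `T`; the radii of the gates decrease so fast that members missing
a given gate can still be found where they are needed. Passing to the avoiding core of the family
makes `K*` meager for `K ∈ I`. If `G` is a `G_δ` set no nonempty relatively open part of which is
countably covered, then the closures of these parts are not in `I`, so they belong to avoidable
families, and a Baire category argument on pairs `(D, x)` with `x ∈ D` shows that `G*` is not
meager in `𝓕`.

If `T` is countably covered, then so are exactly the subsets of `T`, and `𝓕` consists of the
compact sets that meet `T` or contain one of a family of disjoint open cells accumulating at `T`.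

The general case reduces to that of meager members by removing from `E` the largest countably
covered open set.
-/

open Filter Topology

section Topology

variable {X Y : Type*} [TopologicalSpace X] [TopologicalSpace Y]

theorem exists_isOpen_largest [SecondCountableTopology X] {p : Set X → Prop}
    (hp : ∀ 𝒮 : Set (Set X), 𝒮.Countable → (∀ s ∈ 𝒮, p s) → p (⋃₀ 𝒮)) :
    ∃ U, IsOpen U ∧ p U ∧ ∀ O, IsOpen O → p O → O ⊆ U := by
  obtain ⟨𝒮, h𝒮, hsub, hU⟩ := isOpen_sUnion_countable {O | IsOpen O ∧ p O} fun O hO => hO.1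
  exact ⟨⋃₀ {O | IsOpen O ∧ p O}, isOpen_sUnion fun O hO => hO.1,
    hU ▸ hp 𝒮 h𝒮 fun s hs => (hsub hs).2, fun O hO hpO => subset_sUnion_of_mem ⟨hO, hpO⟩⟩

theorem exists_seq_frequently_eq (ι : Type*) [Countable ι] [Nonempty ι] :
    ∃ e : ℕ → ι, ∀ i k, ∃ j ≥ k, e j = i := by
  obtain ⟨f, hf⟩ := exists_surjective_nat ι
  refine ⟨fun j => f j.unpair.1, fun i k => ?_⟩
  obtain ⟨n, rfl⟩ := hf i
  exact ⟨Nat.pair n k, Nat.right_le_pair n k, by simp⟩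

theorem exists_seq_of_forall_update {α : Type*} {p : α → Prop} {P : ℕ → (ℕ → α) → Prop}
    (h₀ : ∃ a, p a)
    (hcongr : ∀ j r r', (∀ i ≤ j + 1, r i = r' i) → P j r → P j r')
    (hstep : ∀ j r, p (r j) → ∃ x, p x ∧ P j (Function.update r (j + 1) x)) :
    ∃ r : ℕ → α, (∀ j, p (r j)) ∧ ∀ j, P j r := by
  obtain ⟨a, ha⟩ := h₀
  have : Nonempty α := ⟨a⟩
  choose! φ hφp hφP using hstep
  let R : ℕ → ℕ → α := fun n => Nat.rec (fun _ => a)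
    (fun j r => Function.update r (j + 1) (φ j r)) n
  have hR : ∀ j, R (j + 1) = Function.update (R j) (j + 1) (φ j (R j)) := fun _ => rfl
  have hagree : ∀ j i, i ≤ j → R j i = R i i := fun j i hij => by
    induction j, hij using Nat.le_induction with
    | base => rfl
    | succ j hij ih => rw [hR, Function.update_of_ne (by omega), ih]
  have hpos : ∀ j, p (R j j) := fun j => by
    induction j with
    | zero => exact ha
    | succ j ih => rw [hR, Function.update_self]; exact hφp _ _ ih
  exact ⟨fun j => R j j, hpos, fun j =>
    hcongr j (R (j + 1)) _ (fun i hi => hagree _ i hi) (hφP j (R j) (hpos j))⟩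

theorem isMeagre_preimage_of_forall_dense {f : X → Y} (hf : Continuous f)
    (hdense : ∀ U, IsOpen U → Dense U → Dense (f ⁻¹' U)) {s : Set Y} (hs : IsMeagre s) :
    IsMeagre (f ⁻¹' s) := by
  obtain ⟨𝒮, hopen, hd, hcount, hsub⟩ := mem_residual_iff.1 hs
  refine mem_residual_iff.2 ⟨preimage f '' 𝒮, ?_, ?_, hcount.image _, ?_⟩
  · exact forall_mem_image.2 fun U hU => (hopen U hU).preimage hf
  · exact forall_mem_image.2 fun U hU => hdense U (hopen U hU) (hd U hU)
  · rw [sInter_image, ← preimage_iInter₂, ← sInter_eq_biInter]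
    exact preimage_mono hsub

theorem IsMeagerIn.mono {𝒜 ℬ 𝓕 : Set X} (h : IsMeagerIn ℬ 𝓕) (hsub : 𝒜 ⊆ ℬ) :
    IsMeagerIn 𝒜 𝓕 :=
  IsMeagre.mono (preimage_mono hsub) h

theorem isMeagerIn_of_isClosed_of_subset_closure {𝒜 𝓕 : Set X} (h𝒜 : IsClosed 𝒜)
    (h : 𝓕 ⊆ closure (𝓕 \ 𝒜)) : IsMeagerIn 𝒜 𝓕 := by
  refine IsNowhereDense.isMeagre ?_
  rw [(h𝒜.preimage continuous_subtype_val).isNowhereDense_iff,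
    interior_eq_empty_iff_dense_compl, Subtype.dense_iff, ← preimage_compl,
    Subtype.image_preimage_coe]
  exact h

theorem isMeagerIn_image_iff {f : X → Y} (hf : IsEmbedding f) {𝒜 : Set Y} {𝓕 : Set X} :
    IsMeagerIn 𝒜 (f '' 𝓕) ↔ IsMeagerIn (f ⁻¹' 𝒜) 𝓕 := by
  let e : 𝓕 ≃ₜ f '' 𝓕 := hf.homeomorphImage 𝓕
  change IsMeagre ((↑) ⁻¹' 𝒜 : Set (f '' 𝓕)) ↔ IsMeagre (e ⁻¹' ((↑) ⁻¹' 𝒜))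
  refine ⟨fun h => h.preimage_of_isOpenMap e.continuous e.isOpenMap, fun h => ?_⟩
  rw [← image_preimage_eq ((↑) ⁻¹' 𝒜 : Set (f '' 𝓕)) e.surjective]
  exact e.isInducing.isMeagre_image h

end Topology

section LocallyFiniteOff

variable {X ι : Type*} [TopologicalSpace X] {T : Set X} {u : ι → Set X}

/-- Local finiteness of the family `u` at the points outside `T`. Since nothing is asked at the
points of `T`, where the sets `u a` may accumulate, this is weaker than `LocallyFinite u`. -/
def LocallyFiniteOff (T : Set X) (u : ι → Set X) : Prop :=
  ∀ x ∉ T, ∃ O ∈ 𝓝 x, {a | (u a ∩ O).Nonempty}.Finite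

theorem LocallyFiniteOff.mono {v : ι → Set X} (hu : LocallyFiniteOff T u) (h : ∀ a, v a ⊆ u a) :
    LocallyFiniteOff T v := fun x hx =>
  let ⟨O, hO, hfin⟩ := hu x hx
  ⟨O, hO, hfin.subset fun a => Nonempty.mono (inter_subset_inter_left O (h a))⟩

theorem LocallyFiniteOff.closure (hu : LocallyFiniteOff T u) :
    LocallyFiniteOff T fun a => closure (u a) := by
  intro x hx
  obtain ⟨O, hO, hfin⟩ := hu x hx
  refine ⟨interior O, interior_mem_nhds.2 hO, hfin.subset fun a ha => ?_⟩
  exact ((closure_inter_open_nonempty_iff isOpen_interior).1 ha).mono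
    (inter_subset_inter_right _ interior_subset)

theorem LocallyFiniteOff.isClosed_union_iUnion (hu : LocallyFiniteOff T u) (hT : IsClosed T)
    (hclosed : ∀ a, IsClosed (u a)) : IsClosed (T ∪ ⋃ a, u a) := by
  rw [← isOpen_compl_iff, isOpen_iff_mem_nhds]
  intro x hx
  simp only [mem_compl_iff, mem_union, mem_iUnion, not_or, not_exists] at hx
  obtain ⟨O, hO, hfin⟩ := hu x hx.1
  filter_upwards [hO, hT.isOpen_compl.mem_nhds hx.1,
    (biInter_mem hfin).2 fun a _ => (hclosed a).isOpen_compl.mem_nhds (hx.2 a)] with y hyO hyT hy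
  simp only [mem_compl_iff, mem_union, mem_iUnion, not_or, not_exists]
  exact ⟨hyT, fun a ha => mem_iInter₂.1 hy a ⟨y, ha, hyO⟩ ha⟩

theorem LocallyFiniteOff.closure_iUnion_subset (hu : LocallyFiniteOff T u) (hT : IsClosed T) :
    _root_.closure (⋃ a, u a) ⊆ T ∪ ⋃ a, _root_.closure (u a) :=
  closure_minimal ((iUnion_mono fun _ => subset_closure).trans subset_union_right)
    (hu.closure.isClosed_union_iUnion hT fun _ => isClosed_closure)

theorem LocallyFiniteOff.exists_isOpen_superset (hu : LocallyFiniteOff T u) {K : Set X}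
    (hK : IsCompact K) (hKT : Disjoint K T) :
    ∃ O, IsOpen O ∧ K ⊆ O ∧ {a | (u a ∩ O).Nonempty}.Finite := by
  refine hK.induction_on (p := fun s => ∃ O, IsOpen O ∧ s ⊆ O ∧ {a | (u a ∩ O).Nonempty}.Finite)
    ⟨∅, isOpen_empty, subset_rfl, by simp⟩ ?_ ?_ fun x hx => ?_
  · rintro s t hst ⟨O, hO, htO, hfin⟩
    exact ⟨O, hO, hst.trans htO, hfin⟩
  · rintro s t ⟨O, hO, hsO, hfin⟩ ⟨O', hO', htO', hfin'⟩
    refine ⟨O ∪ O', hO.union hO', union_subset_union hsO htO', ?_⟩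
    simpa only [inter_union_distrib_left, union_nonempty, ofPred_or] using hfin.union hfin'
  · obtain ⟨O, hO, hfin⟩ := hu x (disjoint_left.1 hKT hx)
    refine ⟨interior O, mem_nhdsWithin_of_mem_nhds (interior_mem_nhds.2 hO), interior O,
      isOpen_interior, subset_rfl, hfin.subset fun a ha => ?_⟩
    exact ha.mono (inter_subset_inter_right _ interior_subset)

end LocallyFiniteOff

section HitSet

variable {E : Type*} [TopologicalSpace E]

theorem hitSet_mono {A B : Set E} (h : A ⊆ B) : hitSet A ⊆ hitSet B :=
  fun _ hD => hD.mono (inter_subset_inter_right _ h)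

theorem notMem_hitSet_iff {A : Set E} {D : Compacts E} :
    D ∉ hitSet A ↔ Disjoint (D : Set E) A :=
  not_nonempty_iff_eq_empty.trans disjoint_iff_inter_eq_empty.symm

theorem isUpwardClosed_hitSet (A : Set E) : IsUpwardClosed (hitSet A) :=
  fun _ hD _ hDD' => hD.mono (inter_subset_inter_left A hDD')

theorem isClosed_hitSet {A : Set E} (hA : IsClosed A) : IsClosed (hitSet A) :=
  Compacts.isClosed_inter_nonempty_of_isClosed hA

theorem isOpen_hitSet {A : Set E} (hA : IsOpen A) : IsOpen (hitSet A) :=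
  Compacts.isOpen_inter_nonempty_of_isOpen hA

theorem isOpen_setOfPred_disjoint {A : Set E} (hA : IsClosed A) :
    IsOpen {D : Compacts E | Disjoint (D : Set E) A} := by
  simp only [← notMem_hitSet_iff]
  exact (isClosed_hitSet hA).isOpen_compl

theorem isClosed_setOfPred_mem [T2Space E] : IsClosed {q : Compacts E × E | q.2 ∈ q.1} := by
  have hopen := Compacts.isOpen_setOfPred_disjoint_coe (α := E).preimage
    (continuous_fst.prodMk (Compacts.continuous_singleton.comp continuous_snd))
  rw [← isOpen_compl_iff]
  convert hopen using 1
  ext q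
  simp

theorem isClosed_setOfPred_superset [T1Space E] (s : Set E) :
    IsClosed {D : Compacts E | s ⊆ D} := by
  have : {D : Compacts E | s ⊆ D} = ⋂ x ∈ s, hitSet {x} := by
    ext D
    simp [hitSet, subset_def]
  rw [this]
  exact isClosed_biInter fun x _ => isClosed_hitSet isClosed_singleton

theorem exists_superset_mem_forall_mem_hitSet {O : Set (Compacts E)} (hO : IsOpen O)
    {D : Compacts E} (hD : D ∈ O) {ι : Type*} (s : Finset ι) {U : ι → Set E}
    (hU : ∀ i ∈ s, D ∈ hitSet (closure (U i))) :
    ∃ D' ∈ O, (D : Set E) ⊆ D' ∧ ∀ i ∈ s, D' ∈ hitSet (U i) := by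
  classical
  induction s using Finset.induction_on with
  | empty => exact ⟨D, hD, subset_rfl, by simp⟩
  | insert i s _ ih =>
    obtain ⟨D', hD'O, hDD', hD'⟩ := ih fun k hk => hU k (Finset.mem_insert_of_mem hk)
    obtain ⟨x, hxD, hx⟩ := hU i (Finset.mem_insert_self i s)
    have hcont : Continuous fun a : E => D' ⊔ ({a} : Compacts E) :=
      continuous_const.sup Compacts.continuous_singleton
    have hD'x : D' ⊔ {x} = D' :=
      sup_eq_left.2 (SetLike.coe_subset_coe.1 (by simpa using hDD' hxD))
    obtain ⟨a, haO, haU⟩ := mem_closure_iff.1 hx _ (hO.preimage hcont) (by simpa [hD'x])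
    have hsub : (D' : Set E) ⊆ (D' ⊔ {a} : Compacts E) := subset_union_left
    refine ⟨D' ⊔ {a}, haO, hDD'.trans hsub, Finset.forall_mem_insert _ _ _ |>.2 ⟨?_, ?_⟩⟩
    · exact ⟨a, .inr rfl, haU⟩
    · exact fun k hk => isUpwardClosed_hitSet (U k) D' (hD' k hk) _ hsub

theorem mem_closure_finite_subset_of_dense {s : Set E} (hs : Dense s) (D : Compacts E) :
    D ∈ closure {Q : Compacts E | (Q : Set E).Finite ∧ (Q : Set E) ⊆ s} := by
  rw [Compacts.closure_finite_subsets, hs.closure_eq]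
  exact subset_univ (D : Set E)

end HitSet

section EDist

variable {E : Type*} [MetricSpace E]

theorem edist_sup_le {D Q : Compacts E} {δ : ℝ}
    (hQ : ∀ x ∈ Q, ∃ y ∈ D, dist x y ≤ δ) : edist (D ⊔ Q) D ≤ ENNReal.ofReal δ := by
  rw [Compacts.edist_eq]
  refine Metric.hausdorffEDist_le_of_mem_edist ?_ fun x hx => ⟨x, .inl hx, by simp⟩
  rintro x (hx | hx)
  · exact ⟨x, hx, by simp⟩
  · obtain ⟨y, hy, hxy⟩ := hQ x hx
    exact ⟨y, hy, by rw [edist_dist]; exact ENNReal.ofReal_le_ofReal hxy⟩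

theorem subset_thickening_of_edist_lt {D D' : Compacts E} {δ : ℝ}
    (h : edist D' D < ENNReal.ofReal δ) : (D' : Set E) ⊆ Metric.thickening δ (D : Set E) := by
  intro x hx
  rw [Compacts.edist_eq] at h
  obtain ⟨y, hy, hxy⟩ := Metric.exists_edist_lt_of_hausdorffEDist_lt hx h
  exact Metric.mem_thickening_iff.2 ⟨y, hy, by rwa [edist_lt_ofReal] at hxy⟩

theorem exists_eball_subset_of_mem_nhds {X : Type*} [PseudoEMetricSpace X] {x : X} {N : Set X}
    (hN : N ∈ 𝓝 x) : ∃ δ : ℝ, 0 < δ ∧ Metric.eball x (ENNReal.ofReal δ) ⊆ N := by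
  obtain ⟨ε, hε, hεN⟩ := EMetric.mem_nhds_iff.1 hN
  obtain ⟨δ, hδ, hδε⟩ := ENNReal.lt_iff_exists_nnreal_btwn.1 hε
  refine ⟨δ, by exact_mod_cast hδ, (Metric.eball_subset_eball ?_).trans hεN⟩
  simpa using hδε.le

theorem exists_forall_sup_mem_of_mem_nhds {D : Compacts E} {N : Set (Compacts E)} (hN : N ∈ 𝓝 D)
    {x : E} (hx : x ∈ D) :
    ∃ ε > 0, ∀ᶠ D' in 𝓝 D, ∀ Q : Compacts E, (Q : Set E) ⊆ Metric.closedBall x ε → D' ⊔ Q ∈ N := by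
  obtain ⟨δ, hδ, hδN⟩ := exists_eball_subset_of_mem_nhds hN
  have hδ2 : 0 < ENNReal.ofReal (δ / 2) := ENNReal.ofReal_pos.2 (half_pos hδ)
  refine ⟨δ / 2, half_pos hδ, ?_⟩
  filter_upwards [Metric.eball_mem_nhds D hδ2] with D' hD' Q hQ
  refine hδN ?_
  have hDQ : edist (D ⊔ Q) D ≤ ENNReal.ofReal (δ / 2) := edist_sup_le fun y hy => ⟨x, hx, hQ hy⟩
  have hD'Q : edist (D' ⊔ Q) (D ⊔ Q) ≤ edist D' D := by
    have := Compacts.lipschitz_sup.edist_le_mul (D', Q) (D, Q)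
    simpa [Prod.edist_eq] using this
  calc edist (D' ⊔ Q) D ≤ edist (D' ⊔ Q) (D ⊔ Q) + edist (D ⊔ Q) D := edist_triangle _ _ _
    _ < ENNReal.ofReal (δ / 2) + ENNReal.ofReal (δ / 2) :=
      ENNReal.add_lt_add_of_lt_of_le (hDQ.trans_lt ENNReal.ofReal_lt_top).ne (hD'Q.trans_lt hD') hDQ
    _ = ENNReal.ofReal δ := by rw [← ENNReal.ofReal_add (by positivity) (by positivity), add_halves]

end EDist

section CountablyCovered

variable {E : Type*} [TopologicalSpace E] {I : Set (Compacts E)}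

theorem HasPropertyStar.mem_of_subset (hstar : HasPropertyStar I) {K L : Compacts E} (hK : K ∈ I)
    (hLK : (L : Set E) ⊆ K) : L ∈ I :=
  let ⟨_, _, hKG, hGI⟩ := hstar (fun _ => K) fun _ => hK
  hGI L (hLK.trans ((subset_iUnion (fun _ : ℕ => (K : Set E)) 0).trans hKG))

theorem isCountablyCovered_of_mem {K : Compacts E} (hK : K ∈ I) :
    IsCountablyCovered I (K : Set E) :=
  ⟨fun _ => K, fun _ => hK, subset_iUnion (fun _ : ℕ => (K : Set E)) 0⟩

theorem isCountablyCovered_empty (hI : I.Nonempty) : IsCountablyCovered I (∅ : Set E) :=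
  let ⟨K, hK⟩ := hI
  ⟨fun _ => K, fun _ => hK, empty_subset _⟩

theorem IsCountablyCovered.ideal_nonempty {A : Set E} (hA : IsCountablyCovered I A) :
    I.Nonempty :=
  let ⟨K, hK, _⟩ := hA
  ⟨K 0, hK 0⟩

theorem IsCountablyCovered.mono {A B : Set E} (hB : IsCountablyCovered I B) (h : A ⊆ B) :
    IsCountablyCovered I A :=
  let ⟨K, hK, hBK⟩ := hB
  ⟨K, hK, h.trans hBK⟩

theorem isCountablyCovered_iUnion (hI : I.Nonempty) {ι : Type*} [Countable ι] {A : ι → Set E}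
    (hA : ∀ i, IsCountablyCovered I (A i)) : IsCountablyCovered I (⋃ i, A i) := by
  cases isEmpty_or_nonempty ι
  · simpa using isCountablyCovered_empty hI
  choose K hK hAK using hA
  obtain ⟨f, hf⟩ := exists_surjective_nat (ι × ℕ)
  refine ⟨fun n => K (f n).1 (f n).2, fun n => hK _ _, ?_⟩
  rw [hf.iUnion_comp fun q => (K q.1 q.2 : Set E), iUnion_prod']
  exact iUnion_mono hAK

theorem isCountablyCovered_biUnion (hI : I.Nonempty) {ι : Type*} {s : Set ι} (hs : s.Countable)
    {A : ι → Set E} (hA : ∀ i ∈ s, IsCountablyCovered I (A i)) :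
    IsCountablyCovered I (⋃ i ∈ s, A i) := by
  have := hs.to_subtype
  rw [biUnion_eq_iUnion]
  exact isCountablyCovered_iUnion hI fun i => hA i i.2

theorem IsCountablyCovered.union {A B : Set E} (hA : IsCountablyCovered I A)
    (hB : IsCountablyCovered I B) : IsCountablyCovered I (A ∪ B) := by
  rw [union_eq_iUnion]
  exact isCountablyCovered_iUnion hA.ideal_nonempty (by simp [hA, hB])

theorem IsCountablyCovered.dense_compl [BaireSpace E] {A : Set E} (hA : IsCountablyCovered I A)
    (hmeagre : ∀ K ∈ I, IsMeagre (K : Set E)) : Dense Aᶜ :=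
  let ⟨_, hK, hAK⟩ := hA
  dense_of_mem_residual ((isMeagre_iUnion fun n => hmeagre _ (hK n)).mono hAK)

theorem IsCountablyCovered.isMeagerIn_hitSet {𝓕 : Set (Compacts E)} {G : Set E}
    (hG : IsCountablyCovered I G) (h : ∀ K ∈ I, IsMeagerIn (hitSet (K : Set E)) 𝓕) :
    IsMeagerIn (hitSet G) 𝓕 := by
  obtain ⟨K, hK, hGK⟩ := hG
  refine (isMeagre_iUnion fun n => h (K n) (hK n)).mono ?_
  rintro D ⟨x, hxD, hxG⟩
  obtain ⟨n, hn⟩ := mem_iUnion.1 (hGK hxG)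
  exact mem_iUnion.2 ⟨n, x, hxD, hn⟩

theorem exists_isOpen_largest_isCountablyCovered_inter [SecondCountableTopology E]
    (hI : I.Nonempty) (G : Set E) :
    ∃ U, IsOpen U ∧ IsCountablyCovered I (G ∩ U) ∧
      ∀ O, IsOpen O → IsCountablyCovered I (G ∩ O) → O ⊆ U := by
  refine exists_isOpen_largest fun 𝒮 h𝒮 h => ?_
  rw [sUnion_eq_biUnion, inter_iUnion₂]
  exact isCountablyCovered_biUnion hI h𝒮 h

theorem exists_isGδ_locally_not_isCountablyCovered {E : Type*} [PseudoMetricSpace E]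
    [SecondCountableTopology E] {I : Set (Compacts E)} (hI : I.Nonempty) {G : Set E} (hG : IsGδ G)
    (hcov : ¬ IsCountablyCovered I G) :
    ∃ G' ⊆ G, IsGδ G' ∧ G'.Nonempty ∧
      ∀ O, IsOpen O → (G' ∩ O).Nonempty → ¬ IsCountablyCovered I (G' ∩ O) := by
  obtain ⟨U, hUo, hU, hmax⟩ := exists_isOpen_largest_isCountablyCovered_inter hI G
  refine ⟨G \ U, sdiff_subset, hG.inter hUo.isClosed_compl.isGδ, ?_, ?_⟩
  · rw [nonempty_iff_ne_empty, Ne, sdiff_eq_empty]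
    exact fun hGU => hcov (hU.mono (subset_inter subset_rfl hGU))
  · rintro O hO ⟨x, ⟨-, hxU⟩, hxO⟩ hGO
    refine hxU (hmax O hO ((hGO.union hU).mono ?_) hxO)
    rintro y ⟨hyG, hyO⟩
    by_cases hyU : y ∈ U
    exacts [.inr ⟨hyG, hyU⟩, .inl ⟨⟨hyG, hyU⟩, hyO⟩]

end CountablyCovered

section Avoidable

variable {E : Type*} [TopologicalSpace E] {I : Set (Compacts E)}

/-- The compact sets that intersect every member of `C`. -/
def transversals (C : Set (Compacts E)) : Set (Compacts E) :=
  {D | ∀ M ∈ C, D ∈ hitSet (M : Set E)}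

/-- `C` is avoidable for `I` if no countable union of members of `I` intersects all the
transversals of `C`. -/
def IsAvoidable (I C : Set (Compacts E)) : Prop :=
  ∀ A : Set E, IsCountablyCovered I A → ∃ D ∈ transversals C, Disjoint (D : Set E) A

/-- `S` is covered by countably many avoidable families. -/
def IsSigmaAvoidable (I S : Set (Compacts E)) : Prop :=
  ∃ 𝒞 : Set (Set (Compacts E)), 𝒞.Countable ∧ (∀ C ∈ 𝒞, IsAvoidable I C) ∧ S ⊆ ⋃₀ 𝒞

theorem isClosed_transversals [T2Space E] (C : Set (Compacts E)) : IsClosed (transversals C) := by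
  simp only [transversals, ofPred_forall]
  exact isClosed_biInter fun M _ => isClosed_hitSet M.isCompact.isClosed

theorem isUpwardClosed_transversals (C : Set (Compacts E)) : IsUpwardClosed (transversals C) :=
  fun D hD D' hDD' M hM => isUpwardClosed_hitSet (M : Set E) D (hD M hM) D' hDD'

theorem IsAvoidable.isSigmaAvoidable {C : Set (Compacts E)} (h : IsAvoidable I C) :
    IsSigmaAvoidable I C :=
  ⟨{C}, countable_singleton C, by simpa, by simp⟩

theorem IsAvoidable.exists_mem_transversals_sep {C : Set (Compacts E)} (hC : IsAvoidable I C)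
    {F : Set E} (hF : IsClosed F) {A : Set E} (hA : IsCountablyCovered I A) :
    ∃ D ∈ transversals {M ∈ C | (M : Set E) ⊆ F}, (D : Set E) ⊆ F ∧ Disjoint (D : Set E) A := by
  obtain ⟨D, hD, hDA⟩ := hC A hA
  refine ⟨⟨D ∩ F, D.isCompact.inter_right hF⟩, fun M hM => ?_, inter_subset_right,
    hDA.mono_left inter_subset_left⟩
  obtain ⟨x, hxD, hxM⟩ := hD M hM.1
  exact ⟨x, ⟨hxD, hM.2 hxM⟩, hxM⟩

theorem IsSigmaAvoidable.mono {S S' : Set (Compacts E)} (h : IsSigmaAvoidable I S)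
    (hS : S' ⊆ S) : IsSigmaAvoidable I S' :=
  let ⟨𝒞, h𝒞, hav, hsub⟩ := h
  ⟨𝒞, h𝒞, hav, hS.trans hsub⟩

theorem isSigmaAvoidable_biUnion {ι : Type*} {s : Set ι} (hs : s.Countable)
    {S : ι → Set (Compacts E)} (h : ∀ i ∈ s, IsSigmaAvoidable I (S i)) :
    IsSigmaAvoidable I (⋃ i ∈ s, S i) := by
  choose! 𝒞 h𝒞 hav hsub using h
  refine ⟨⋃ i ∈ s, 𝒞 i, hs.biUnion h𝒞, fun C hC => ?_, iUnion₂_subset fun i hi => ?_⟩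
  · obtain ⟨i, hi, hCi⟩ := mem_iUnion₂.1 hC
    exact hav i hi C hCi
  · exact (hsub i hi).trans (sUnion_subset_sUnion (subset_biUnion_of_mem (u := 𝒞) hi))

theorem IsSigmaAvoidable.union {S S' : Set (Compacts E)} (h : IsSigmaAvoidable I S)
    (h' : IsSigmaAvoidable I S') : IsSigmaAvoidable I (S ∪ S') := by
  obtain ⟨𝒞, h𝒞, hav, hsub⟩ := h
  obtain ⟨𝒞', h𝒞', hav', hsub'⟩ := h'
  refine ⟨𝒞 ∪ 𝒞', h𝒞.union h𝒞', fun C hC => hC.elim (hav C) (hav' C), ?_⟩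
  rw [sUnion_union]
  exact union_subset_union hsub hsub'

theorem exists_isCountablyCovered_forall_transversals [SecondCountableTopology (Compacts E)]
    (hI : I.Nonempty) {H : Set (Compacts E)}
    (hH : ∀ N, IsOpen N → (N ∩ H).Nonempty → ¬ IsAvoidable I (N ∩ H)) :
    ∃ A, IsCountablyCovered I A ∧ ∀ N, IsOpen N → (N ∩ H).Nonempty →
      ∀ D ∈ transversals (N ∩ H), ¬ Disjoint (D : Set E) A := by
  let 𝒮 := {N ∈ countableBasis (Compacts E) | (N ∩ H).Nonempty}
  have hex : ∀ N ∈ 𝒮, ∃ A, IsCountablyCovered I A ∧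
      ∀ D ∈ transversals (N ∩ H), ¬ Disjoint (D : Set E) A := by
    intro N hN
    have := hH N (isOpen_of_mem_countableBasis hN.1) hN.2
    simpa only [IsAvoidable, not_forall, not_exists, not_and, exists_prop] using this
  choose! A hA hAD using hex
  have h𝒮 : 𝒮.Countable := (countable_countableBasis _).mono (sep_subset _ _)
  refine ⟨⋃ N ∈ 𝒮, A N, isCountablyCovered_biUnion hI h𝒮 hA, ?_⟩
  rintro N hN ⟨M, hMN, hMH⟩ D hD hDA
  obtain ⟨N', hN', hMN', hN'N⟩ :=
    (isBasis_countableBasis (Compacts E)).exists_subset_of_mem_open hMN hN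
  have hN'𝒮 : N' ∈ 𝒮 := ⟨hN', M, hMN', hMH⟩
  exact hAD N' hN'𝒮 D (fun M' hM' => hD M' (inter_subset_inter_left H hN'N hM'))
    (hDA.mono_right (subset_biUnion_of_mem (u := A) hN'𝒮))

/- If `P ⊇ A` is open, then `Pᶜ` misses `A`, hence is not a transversal of `N ∩ H`: some member of
`N ∩ H` is a subset of `P`. -/
theorem inter_nonempty_of_forall_not_isAvoidable [CompactSpace E] [T2Space E]
    [SecondCountableTopology E] (hI : I.Nonempty) (hstar : HasPropertyStar I)
    {H : Set (Compacts E)} (hHc : IsClosed H) (hne : H.Nonempty)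
    (hH : ∀ N, IsOpen N → (N ∩ H).Nonempty → ¬ IsAvoidable I (N ∩ H)) : (H ∩ I).Nonempty := by
  obtain ⟨A, ⟨K, hK, hAK⟩, hAD⟩ := exists_isCountablyCovered_forall_transversals hI hH
  obtain ⟨G, hG, hKG, hGI⟩ := hstar K hK
  obtain ⟨P, hP, rfl⟩ := isGδ_iff_eq_iInter_nat.1 hG
  have : CompactSpace H := isCompact_iff_compactSpace.1 hHc.isCompact
  have : Nonempty H := hne.to_subtype
  have hopen : ∀ k, IsOpen {M : H | (M.1 : Set E) ⊆ P k} := fun k =>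
    (Compacts.isOpen_subsets_of_isOpen (hP k)).preimage continuous_subtype_val
  have hdense : ∀ k, Dense {M : H | (M.1 : Set E) ⊆ P k} := by
    intro k
    rw [dense_iff_inter_open]
    rintro _ ⟨N, hN, rfl⟩ ⟨M, hMN⟩
    let D : Compacts E := ⟨(P k)ᶜ, (hP k).isClosed_compl.isCompact⟩
    have hDA : Disjoint (D : Set E) A :=
      disjoint_compl_left_iff_subset.2 ((hAK.trans hKG).trans (iInter_subset P k))
    have hD : D ∉ transversals (N ∩ H) := fun hD => hAD N hN ⟨M, hMN, M.2⟩ D hD hDA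
    simp only [transversals, mem_ofPred_eq, not_forall, notMem_hitSet_iff] at hD
    obtain ⟨M', ⟨hM'N, hM'H⟩, hdisj⟩ := hD
    exact ⟨⟨M', hM'H⟩, hM'N, disjoint_compl_left_iff_subset.1 hdisj⟩
  obtain ⟨M, hM⟩ := (dense_iInter_of_isOpen hopen hdense).nonempty
  exact ⟨M, M.2, hGI M (subset_iInter (mem_iInter.1 hM))⟩

theorem isSigmaAvoidable_of_isClosed_of_disjoint [CompactSpace E] [T2Space E]
    [SecondCountableTopology E] (hI : I.Nonempty) (hstar : HasPropertyStar I)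
    {H : Set (Compacts E)} (hH : IsClosed H) (hHI : Disjoint H I) : IsSigmaAvoidable I H := by
  obtain ⟨U, hUo, hU, hmax⟩ := exists_isOpen_largest
    (p := fun N => IsSigmaAvoidable I (N ∩ H)) fun 𝒮 h𝒮 h => by
      rw [sUnion_eq_biUnion, iUnion₂_inter]
      exact isSigmaAvoidable_biUnion h𝒮 h
  suffices H \ U = ∅ from hU.mono (subset_inter (sdiff_eq_empty.1 this) subset_rfl)
  by_contra hne
  obtain ⟨M, hM, hMI⟩ := inter_nonempty_of_forall_not_isAvoidable hI hstar (hH.sdiff hUo)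
    (nonempty_iff_ne_empty.2 hne) fun N hN ⟨M, hMN, _, hMU⟩ hav => by
      refine hMU (hmax N hN ((hav.isSigmaAvoidable.union hU).mono ?_) hMN)
      rintro M' ⟨hM'N, hM'H⟩
      by_cases hM'U : M' ∈ U
      exacts [.inr ⟨hM'U, hM'H⟩, .inl ⟨hM'N, hM'H, hM'U⟩]
  exact disjoint_left.1 hHI hM.1 hMI

theorem isSigmaAvoidable_compl [CompactSpace E] [T2Space E] [SecondCountableTopology E]
    (hI : I.Nonempty) (hGδ : IsGδ I) (hstar : HasPropertyStar I) : IsSigmaAvoidable I Iᶜ := by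
  obtain ⟨𝒮, hopen, h𝒮, rfl⟩ := hGδ
  rw [compl_sInter, sUnion_image]
  refine isSigmaAvoidable_biUnion h𝒮 fun U hU => ?_
  exact isSigmaAvoidable_of_isClosed_of_disjoint hI hstar (hopen U hU).isClosed_compl
    (disjoint_compl_left_iff_subset.2 (sInter_subset_of_mem hU))

end Avoidable

section Core

variable {E : Type*} [TopologicalSpace E] {I S : Set (Compacts E)}

/-- The part of the closure of `S` that persists when only the members of `S` disjoint from a
given countable union of members of `I` are kept, whichever this countable union is. -/
def avoidingCore (I S : Set (Compacts E)) : Set (Compacts E) :=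
  {D | ∀ A, IsCountablyCovered I A → D ∈ closure {D' ∈ S | Disjoint (D' : Set E) A}}

theorem isClosed_avoidingCore : IsClosed (avoidingCore I S) := by
  simp only [avoidingCore, ofPred_forall]
  exact isClosed_iInter fun _ => isClosed_iInter fun _ => isClosed_closure

theorem avoidingCore_subset (hI : I.Nonempty) (hS : IsClosed S) : avoidingCore I S ⊆ S :=
  fun _ hD => hS.closure_subset_iff.2 (sep_subset _ _) (hD ∅ (isCountablyCovered_empty hI))

theorem exists_forall_disjoint_mem_avoidingCore [SecondCountableTopology (Compacts E)]
    (hI : I.Nonempty) (S : Set (Compacts E)) :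
    ∃ A, IsCountablyCovered I A ∧ ∀ D ∈ S, Disjoint (D : Set E) A → D ∈ avoidingCore I S := by
  obtain ⟨U, -, ⟨A, hA, hAU⟩, hmax⟩ := exists_isOpen_largest
    (p := fun U => ∃ A, IsCountablyCovered I A ∧ ∀ D ∈ S, Disjoint (D : Set E) A → D ∉ U)
    fun 𝒮 h𝒮 h => by
      choose! A hA hAU using h
      refine ⟨⋃ U ∈ 𝒮, A U, isCountablyCovered_biUnion hI h𝒮 hA, ?_⟩
      rintro D hD hDA ⟨U, hU, hDU⟩
      exact hAU U hU D hD (hDA.mono_right (subset_biUnion_of_mem (u := A) hU)) hDU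
  refine ⟨A, hA, fun D hD hDA B hB => ?_⟩
  by_contra hDB
  refine hAU D hD hDA (hmax _ isClosed_closure.isOpen_compl ⟨B, hB, ?_⟩ hDB)
  exact fun D' hD' hD'B => not_not_intro (subset_closure ⟨hD', hD'B⟩)

theorem avoidingCore_subset_closure [SecondCountableTopology (Compacts E)] {A : Set E}
    (hA : IsCountablyCovered I A) :
    avoidingCore I S ⊆ closure {D ∈ avoidingCore I S | Disjoint (D : Set E) A} := by
  obtain ⟨B, hB, hBS⟩ := exists_forall_disjoint_mem_avoidingCore hA.ideal_nonempty S
  intro D hD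
  refine closure_mono ?_ (hD _ (hA.union hB))
  rintro D' ⟨hD'S, hD'⟩
  rw [disjoint_union_right] at hD'
  exact ⟨hBS D' hD'S hD'.2, hD'.1⟩

theorem isMeagerIn_hitSet_avoidingCore [T2Space E] [SecondCountableTopology (Compacts E)]
    {K : Compacts E} (hK : K ∈ I) : IsMeagerIn (hitSet (K : Set E)) (avoidingCore I S) := by
  refine isMeagerIn_of_isClosed_of_subset_closure (isClosed_hitSet K.isCompact.isClosed) ?_
  refine (avoidingCore_subset_closure (isCountablyCovered_of_mem hK)).trans ?_
  exact closure_mono fun D hD => ⟨hD.1, notMem_hitSet_iff.2 hD.2⟩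

theorem isUpwardClosed_avoidingCore [BaireSpace E] (hmeagre : ∀ K ∈ I, IsMeagre (K : Set E))
    (hS : IsUpwardClosed S) : IsUpwardClosed (avoidingCore I S) := by
  intro D hD D₁ hDD₁ A hA
  have hD₁ := mem_closure_finite_subset_of_dense (hA.dense_compl hmeagre) D₁
  rw [← sup_eq_right.2 (SetLike.coe_subset_coe.1 hDD₁)]
  refine map_mem_closure₂ continuous_sup (hD A hA) hD₁ ?_
  rintro D' ⟨hD'S, hD'A⟩ Q ⟨-, hQA⟩
  refine ⟨hS D' hD'S _ (SetLike.coe_subset_coe.2 le_sup_left), ?_⟩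
  rw [Compacts.coe_sup, disjoint_union_left]
  exact ⟨hD'A, subset_compl_iff_disjoint_right.1 hQA⟩

end Core

section Nonmeagre

variable {E : Type*} [MetricSpace E] [CompactSpace E] {𝓕 : Set (Compacts E)} {G : Set E}

theorem IsUpwardClosed.exists_mem_inter_interior_nonempty (h𝓕 : IsUpwardClosed 𝓕)
    (hit : ∀ D ∈ 𝓕, ∀ V, IsOpen V → closure V ⊆ (D : Set E) → (G ∩ V).Nonempty →
      D ∈ closure {D' ∈ 𝓕 | hitSet (closure (G ∩ V)) ∈ 𝓝[𝓕] D'})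
    {N W : Set (Compacts E)} (hN : IsOpen N) (hW : IsOpen W) (hdense : 𝓕 ⊆ closure (𝓕 ∩ W))
    {D : Compacts E} (hD : D ∈ 𝓕) (hDN : D ∈ N) {V : Set E} (hV : IsOpen V)
    (hne : (G ∩ V ∩ interior D).Nonempty) :
    ∃ D' ∈ 𝓕 ∩ (N ∩ W), (G ∩ V ∩ interior (D' : Set E)).Nonempty := by
  obtain ⟨x, ⟨hxG, hxV⟩, hxD⟩ := hne
  obtain ⟨V', hV', hxV', hsub⟩ :
      ∃ V', IsOpen V' ∧ x ∈ V' ∧ closure V' ⊆ V ∩ interior (D : Set E) := by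
    obtain ⟨Z, hZ, hZc, hZV⟩ :=
      exists_mem_nhds_isClosed_subset ((hV.inter isOpen_interior).mem_nhds ⟨hxV, hxD⟩)
    exact ⟨interior Z, isOpen_interior, mem_interior_iff_mem_nhds.2 hZ,
      (closure_minimal interior_subset hZc).trans hZV⟩
  obtain ⟨D', hD'N, hD', hhit⟩ := mem_closure_iff.1
    (hit D hD V' hV' (hsub.trans (inter_subset_right.trans interior_subset)) ⟨x, hxG, hxV'⟩)
    N hN hDN
  obtain ⟨O, hO, hD'O, hOhit⟩ := mem_nhdsWithin.1 hhit
  obtain ⟨D₁, ⟨hD₁N, hD₁O⟩, hD₁, hD₁W⟩ :=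
    mem_closure_iff.1 (hdense hD') (N ∩ O) (hN.inter hO) ⟨hD'N, hD'O⟩
  obtain ⟨y, hyD₁, hy⟩ := hOhit ⟨hD₁O, hD₁⟩
  obtain ⟨ε, hε, hball⟩ := exists_forall_sup_mem_of_mem_nhds
    ((hN.inter hW).mem_nhds ⟨hD₁N, hD₁W⟩) hyD₁
  let Q : Compacts E := ⟨Metric.closedBall y ε, Metric.isClosed_closedBall.isCompact⟩
  obtain ⟨a, hay, haG, haV'⟩ := mem_closure_iff.1 hy _ Metric.isOpen_ball (Metric.mem_ball_self hε)
  have hball_sub : Metric.ball y ε ⊆ (D₁ ⊔ Q : Compacts E) :=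
    Metric.ball_subset_closedBall.trans subset_union_right
  refine ⟨D₁ ⊔ Q, ⟨h𝓕 D₁ hD₁ _ subset_union_left, hball.self_of_nhds Q subset_rfl⟩, a,
    ⟨haG, (hsub (subset_closure haV')).1⟩, interior_maximal hball_sub Metric.isOpen_ball hay⟩

/-- The pairs `(D, x)` with `D ∈ 𝓕` and `x ∈ G` an interior point of `D`. The closure of this set is
the compact space in which the Baire category theorem is applied. -/
def interiorPairs (𝓕 : Set (Compacts E)) (G : Set E) : Set (Compacts E × E) :=
  {q | q.1 ∈ 𝓕 ∧ q.2 ∈ G ∧ q.2 ∈ interior (q.1 : Set E)}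

theorem IsUpwardClosed.interiorPairs_subset_closure (h𝓕 : IsUpwardClosed 𝓕)
    (hit : ∀ D ∈ 𝓕, ∀ V, IsOpen V → closure V ⊆ (D : Set E) → (G ∩ V).Nonempty →
      D ∈ closure {D' ∈ 𝓕 | hitSet (closure (G ∩ V)) ∈ 𝓝[𝓕] D'})
    {W : Set (Compacts E)} (hW : IsOpen W) (hdense : 𝓕 ⊆ closure (𝓕 ∩ W)) :
    interiorPairs 𝓕 G ⊆ closure (interiorPairs 𝓕 G ∩ Prod.fst ⁻¹' W) := by
  rintro ⟨D, x⟩ ⟨hD, hxG, hxD⟩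
  refine mem_closure_iff.2 fun O hO hDx => ?_
  obtain ⟨N, V, hN, hV, hDN, hxV, hNVO⟩ := isOpen_prod_iff.1 hO D x hDx
  obtain ⟨D', ⟨hD', hD'N, hD'W⟩, a, ⟨haG, haV⟩, haD'⟩ :=
    h𝓕.exists_mem_inter_interior_nonempty hit hN hW hdense hD hDN hV ⟨x, ⟨hxG, hxV⟩, hxD⟩
  exact ⟨(D', a), hNVO ⟨hD'N, haV⟩, ⟨hD', haG, haD'⟩, hD'W⟩

theorem IsUpwardClosed.not_isMeagerIn_hitSet (h𝓕 : IsUpwardClosed 𝓕) (hclosed : IsClosed 𝓕)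
    (hne : 𝓕.Nonempty) (hG : IsGδ G) (hGne : G.Nonempty)
    (hit : ∀ D ∈ 𝓕, ∀ V, IsOpen V → closure V ⊆ (D : Set E) → (G ∩ V).Nonempty →
      D ∈ closure {D' ∈ 𝓕 | hitSet (closure (G ∩ V)) ∈ 𝓝[𝓕] D'}) :
    ¬ IsMeagerIn (hitSet G) 𝓕 := by
  intro hmeagre
  let Z := closure (interiorPairs 𝓕 G)
  have hZ𝓕 : ∀ q ∈ Z, q.1 ∈ 𝓕 :=
    closure_minimal (fun q hq => hq.1) (hclosed.preimage continuous_fst)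
  have hZmem : ∀ q ∈ Z, q.2 ∈ q.1 :=
    closure_minimal (fun q hq => interior_subset (s := (q.1 : Set E)) hq.2.2) isClosed_setOfPred_mem
  let π : Z → 𝓕 := fun q => ⟨q.1.1, hZ𝓕 q q.2⟩
  have hπ : Continuous π := (continuous_fst.comp continuous_subtype_val).subtype_mk _
  have hπdense : ∀ U, IsOpen U → Dense U → Dense (π ⁻¹' U) := by
    rintro _ ⟨W, hW, rfl⟩ hdense
    rw [Subtype.dense_iff, Subtype.image_preimage_coe] at hdense
    refine Subtype.dense_iff.2 (closure_minimal ?_ isClosed_closure)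
    refine (h𝓕.interiorPairs_subset_closure hit hW hdense).trans (closure_mono fun q hq => ?_)
    exact ⟨⟨q, subset_closure hq.1⟩, hq.2, rfl⟩
  have hGdense : Dense {q : Z | q.1.2 ∈ G} :=
    Subtype.dense_iff.2 (closure_mono fun q hq => ⟨⟨q, subset_closure hq⟩, hq.2.1, rfl⟩)
  have hGresidual : {q : Z | q.1.2 ∈ G} ∈ residual Z :=
    residual_of_dense_Gδ (hG.preimage (continuous_snd.comp continuous_subtype_val)) hGdense
  have : CompactSpace Z := isCompact_iff_compactSpace.1 isClosed_closure.isCompact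
  have : Nonempty Z := by
    obtain ⟨D, hD⟩ := hne
    obtain ⟨x, hx⟩ := hGne
    exact ⟨(⊤, x), subset_closure ⟨h𝓕 D hD ⊤ (subset_univ _), hx, by simp⟩⟩
  obtain ⟨q, hqG, hqhit⟩ := (dense_of_mem_residual
    (inter_mem hGresidual (isMeagre_preimage_of_forall_dense hπ hπdense hmeagre))).nonempty
  exact hqhit ⟨q.1.2, hZmem q q.2, hqG⟩

end Nonmeagre

section Gates

variable {E : Type*} [MetricSpace E] {I : Set (Compacts E)} {T : Set E}
  {𝒟 𝒩 : ℕ → Set (Compacts E)} {net : ℝ → Set E} {r r' : ℕ → ℝ} {j : ℕ}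

/-- The compact sets that intersect `T` and satisfy the constraints `𝒟 i` for `i ∈ s`. -/
def constrained (T : Set E) (𝒟 : ℕ → Set (Compacts E)) (s : Finset ℕ) : Set (Compacts E) :=
  {D ∈ hitSet T | ∀ i ∈ s, D ∈ 𝒟 i}

/-- The `j`-th gate: the open neighbourhood of radius `r (j + 1)` of the set `net (r j)`, where
`net ε` stands for an `ε`-net of `T`. -/
def gate (net : ℝ → Set E) (r : ℕ → ℝ) (j : ℕ) : Set E :=
  Metric.thickening (r (j + 1)) (net (r j))

/-- The compact sets that intersect `T` and that, for every `j`, can violate the constraint `𝒟 j`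
only if they intersect the closure of the `j`-th gate. -/
def gated (T : Set E) (𝒟 : ℕ → Set (Compacts E)) (net : ℝ → Set E) (r : ℕ → ℝ) :
    Set (Compacts E) :=
  {D ∈ hitSet T | ∀ j, D ∈ hitSet (closure (gate net r j)) ∨ D ∈ 𝒟 j}

/-- The compact sets that belong to the avoiding core of the `j`-th constraint together with
finitely many others, and intersect every earlier gate whose constraint is not one of these. They
are the approximate members of `gated T 𝒟 net r` that depend only on `r 0, …, r j`. -/
def stageWitnesses (I : Set (Compacts E)) (T : Set E) (𝒟 : ℕ → Set (Compacts E))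
    (net : ℝ → Set E) (r : ℕ → ℝ) (j : ℕ) : Set (Compacts E) :=
  {D | ∃ s, D ∈ avoidingCore I (constrained T 𝒟 (insert j s)) ∧
    ∀ i < j, i ∉ s → D ∈ hitSet (gate net r i)}

/-- `r (j + 1)` is small enough: if some stage witness in `𝒩 j` misses the net of mesh `r j`, then
some stage witness in `𝒩 j` even misses the neighbourhood of this net of radius
`3 * r (j + 1)`. -/
def IsAdapted (I : Set (Compacts E)) (T : Set E) (𝒟 𝒩 : ℕ → Set (Compacts E))
    (net : ℝ → Set E) (r : ℕ → ℝ) (j : ℕ) : Prop :=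
  (∃ D ∈ 𝒩 j ∩ stageWitnesses I T 𝒟 net r j, Disjoint (D : Set E) (net (r j))) →
    ∃ D ∈ 𝒩 j ∩ stageWitnesses I T 𝒟 net r j,
      Disjoint (D : Set E) (Metric.thickening (3 * r (j + 1)) (net (r j)))

theorem isClosed_gated (hT : IsClosed T) (h𝒟 : ∀ j, IsClosed (𝒟 j)) :
    IsClosed (gated T 𝒟 net r) := by
  simp only [gated, ofPred_and, ofPred_forall, ofPred_or]
  exact (isClosed_hitSet hT).inter
    (isClosed_iInter fun j => (isClosed_hitSet isClosed_closure).union (h𝒟 j))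

theorem isUpwardClosed_gated (h𝒟 : ∀ j, IsUpwardClosed (𝒟 j)) :
    IsUpwardClosed (gated T 𝒟 net r) := fun D hD D' hDD' =>
  ⟨isUpwardClosed_hitSet T D hD.1 D' hDD', fun j =>
    (hD.2 j).imp (isUpwardClosed_hitSet _ D · D' hDD') (h𝒟 j D · D' hDD')⟩

theorem gate_congr (h : ∀ i ≤ j + 1, r i = r' i) : gate net r j = gate net r' j := by
  rw [gate, gate, h _ le_rfl, h _ j.le_succ]

theorem eventually_forall_mem_hitSet_gate {s : Finset ℕ} {D : Compacts E}
    (hD : ∀ i < j, i ∉ s → D ∈ hitSet (gate net r i)) :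
    ∀ᶠ D' in 𝓝 D, ∀ i < j, i ∉ s → D' ∈ hitSet (gate net r i) :=
  (eventually_all_finite (finite_lt_nat j)).2 fun i hi =>
    eventually_imp_distrib_left.2 fun his =>
      (isOpen_hitSet Metric.isOpen_thickening).eventually_mem (hD i hi his)

theorem stageWitnesses_congr (h : ∀ i ≤ j, r i = r' i) :
    stageWitnesses I T 𝒟 net r j = stageWitnesses I T 𝒟 net r' j := by
  have hgate : ∀ i < j, gate net r i = gate net r' i := fun i hi =>
    gate_congr fun k hk => h k (by omega)
  ext D
  refine exists_congr fun s => and_congr_right fun _ => forall₂_congr fun i hi => ?_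
  rw [hgate i hi]

theorem isAdapted_congr (h : ∀ i ≤ j + 1, r i = r' i) :
    IsAdapted I T 𝒟 𝒩 net r j ↔ IsAdapted I T 𝒟 𝒩 net r' j := by
  rw [IsAdapted, IsAdapted, stageWitnesses_congr fun i hi => h i (by omega), h _ le_rfl,
    h _ j.le_succ]

theorem exists_isAdapted_update (hnet : IsCompact (net (r j))) (hr : 0 < r j) :
    ∃ x, 0 < x ∧ x ≤ r j / 2 ∧ IsAdapted I T 𝒟 𝒩 net (Function.update r (j + 1) x) j := by
  have hcongr : ∀ x, ∀ i ≤ j, Function.update r (j + 1) x i = r i := fun x i hi =>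
    Function.update_of_ne (by omega) _ _
  simp only [IsAdapted, stageWitnesses_congr (hcongr _), hcongr _ j le_rfl, Function.update_self]
  by_cases hex : ∃ D ∈ 𝒩 j ∩ stageWitnesses I T 𝒟 net r j, Disjoint (D : Set E) (net (r j))
  · obtain ⟨D, hD, hdisj⟩ := hex
    obtain ⟨δ, hδ, hδD⟩ := hdisj.symm.exists_thickenings hnet D.isCompact.isClosed
    have hmin : 3 * min (δ / 3) (r j / 2) ≤ δ := by linarith [min_le_left (δ / 3) (r j / 2)]
    refine ⟨min (δ / 3) (r j / 2), by positivity, min_le_right _ _, fun _ => ⟨D, hD, ?_⟩⟩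
    exact hδD.symm.mono (Metric.self_subset_thickening hδ _) (Metric.thickening_mono hmin _)
  · exact ⟨r j / 2, by positivity, le_rfl, fun h => (hex h).elim⟩

theorem exists_forall_isAdapted (I : Set (Compacts E)) (T : Set E) (𝒟 𝒩 : ℕ → Set (Compacts E))
    (hnet : ∀ ε > 0, IsCompact (net ε)) :
    ∃ r : ℕ → ℝ, (∀ j, 0 < r j) ∧ ∀ j, r (j + 1) ≤ r j / 2 ∧ IsAdapted I T 𝒟 𝒩 net r j := by
  refine exists_seq_of_forall_update ⟨1, one_pos⟩ (fun j r r' h => ?_) fun j r hr => ?_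
  · rw [h _ le_rfl, h _ j.le_succ, isAdapted_congr h]
    exact id
  · obtain ⟨x, hx, hxr, hadapted⟩ := exists_isAdapted_update (hnet _ hr) hr
    refine ⟨x, hx, ?_, hadapted⟩
    rwa [Function.update_self, Function.update_of_ne (by omega)]

end Gates

/-- The data from which the representation of the ideal `I` by a family of gated sets is built:
constraints `𝒟 j`, regions `𝒩 j` in which a gated set satisfying the `j`-th constraint is sought,
nets of `T` and a sequence `r` of radii defining the gates. -/
structure IsGateSystem {E : Type*} [MetricSpace E] (I : Set (Compacts E)) (T : Set E)
    (𝒟 𝒩 : ℕ → Set (Compacts E)) (net : ℝ → Set E) (r : ℕ → ℝ) : Prop where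
  isMeagre : ∀ K ∈ I, IsMeagre (K : Set E)
  isClosed_base : IsClosed T
  not_isCountablyCovered : ¬ IsCountablyCovered I T
  isClosed : ∀ j, IsClosed (𝒟 j)
  isUpwardClosed : ∀ j, IsUpwardClosed (𝒟 j)
  isOpen : ∀ j, IsOpen (𝒩 j)
  isCountablyCovered_net : ∀ ε > 0, IsCountablyCovered I (net ε)
  exists_dist_net_lt : ∀ ε > 0, ∀ x ∈ T, ∃ a ∈ net ε, dist x a < ε
  pos : ∀ j, 0 < r j
  le_half : ∀ j, r (j + 1) ≤ r j / 2
  isAdapted : ∀ j, IsAdapted I T 𝒟 𝒩 net r j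

namespace IsGateSystem

variable {E : Type*} [MetricSpace E] {I : Set (Compacts E)} {T : Set E}
  {𝒟 𝒩 : ℕ → Set (Compacts E)} {net : ℝ → Set E} {r : ℕ → ℝ}

theorem ideal_nonempty (h : IsGateSystem I T 𝒟 𝒩 net r) : I.Nonempty :=
  (h.isCountablyCovered_net 1 one_pos).ideal_nonempty

theorem antitone (h : IsGateSystem I T 𝒟 𝒩 net r) : Antitone r :=
  antitone_nat_of_succ_le fun j => by linarith [h.le_half j, h.pos j]

theorem tendsto (h : IsGateSystem I T 𝒟 𝒩 net r) : Tendsto r atTop (𝓝 0) := by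
  have hle : ∀ j, r j ≤ (1 / 2) ^ j * r 0 := fun j =>
    le_geom (by norm_num) j fun k _ => by linarith [h.le_half k]
  have hlim : Tendsto (fun j : ℕ => (1 / 2 : ℝ) ^ j * r 0) atTop (𝓝 0) := by
    simpa using (tendsto_pow_atTop_nhds_zero_of_lt_one (by norm_num : (0 : ℝ) ≤ 1 / 2)
      (by norm_num)).mul_const (r 0)
  exact squeeze_zero (fun j => (h.pos j).le) hle hlim

variable [CompactSpace E]

theorem isUpwardClosed_avoidingCore_gated (h : IsGateSystem I T 𝒟 𝒩 net r) :
    IsUpwardClosed (avoidingCore I (gated T 𝒟 net r)) :=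
  isUpwardClosed_avoidingCore h.isMeagre (isUpwardClosed_gated h.isUpwardClosed)

theorem exists_forall_mem_hitSet_gate (h : IsGateSystem I T 𝒟 𝒩 net r) {A : Set E}
    (hA : IsCountablyCovered I A) {p : E} (hpT : p ∈ T) (hpA : p ∉ A) (j : ℕ) :
    ∃ Q : Compacts E, (Q : Set E) ⊆ Metric.closedBall p (r j) ∧ Disjoint (Q : Set E) A ∧
      ∀ i ≥ j, Q ∈ hitSet (gate net r i) := by
  have hpt : ∀ i, ∃ q ∈ gate net r i, q ∉ A ∧ dist q p < r i := by
    intro i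
    obtain ⟨a, ha, hpa⟩ := h.exists_dist_net_lt _ (h.pos i) p hpT
    obtain ⟨q, ⟨hq, hqp⟩, hqA⟩ := (hA.dense_compl h.isMeagre).inter_open_nonempty
      (gate net r i ∩ Metric.ball p (r i)) (Metric.isOpen_thickening.inter Metric.isOpen_ball)
      ⟨a, Metric.self_subset_thickening (h.pos _) _ ha, by rwa [Metric.mem_ball, dist_comm]⟩
    exact ⟨q, hq, hqA, hqp⟩
  choose q hqgate hqA hqp using hpt
  have hqlim : Tendsto (fun i => q (i + j)) atTop (𝓝 p) := by
    rw [tendsto_iff_dist_tendsto_zero]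
    exact squeeze_zero (fun _ => dist_nonneg) (fun i => (hqp (i + j)).le)
      (h.tendsto.comp (tendsto_add_atTop_nat j))
  refine ⟨⟨insert p (range fun i => q (i + j)), hqlim.isCompact_insert_range⟩, ?_, ?_, ?_⟩
  · refine insert_subset (Metric.mem_closedBall_self (h.pos j).le) (range_subset_iff.2 fun i => ?_)
    exact (hqp _).le.trans (h.antitone (Nat.le_add_left _ _))
  · exact disjoint_insert_left.2 ⟨hpA, disjoint_left.2 (forall_mem_range.2 fun i => hqA _)⟩
  · intro i hij
    exact ⟨q i, .inr ⟨i - j, by simp only [Nat.sub_add_cancel hij]⟩, hqgate i⟩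

theorem exists_mem_avoidingCore_gated (h : IsGateSystem I T 𝒟 𝒩 net r) {j : ℕ} {s : Finset ℕ}
    {D : Compacts E} (hD : D ∈ avoidingCore I (constrained T 𝒟 s))
    (hgate : ∀ i < j, i ∉ s → D ∈ hitSet (gate net r i)) :
    ∃ D' ∈ avoidingCore I (gated T 𝒟 net r), edist D' D < ENNReal.ofReal (2 * r j) := by
  obtain ⟨A, hA, hAcore⟩ :=
    exists_forall_disjoint_mem_avoidingCore h.ideal_nonempty (gated T 𝒟 net r)
  have hr : 0 < ENNReal.ofReal (r j) := ENNReal.ofReal_pos.2 (h.pos j)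
  obtain ⟨D₁, ⟨hD₁D, hD₁gate⟩, ⟨⟨p, hpD, hpT⟩, hD₁⟩, hD₁A⟩ :=
    mem_closure_iff_nhds.1 (hD A hA) _ (inter_mem (Metric.eball_mem_nhds D hr)
      (eventually_forall_mem_hitSet_gate hgate))
  obtain ⟨Q, hQp, hQA, hQgate⟩ :=
    h.exists_forall_mem_hitSet_gate hA hpT (disjoint_left.1 hD₁A hpD) j
  have hsub : (D₁ : Set E) ⊆ (D₁ ⊔ Q : Compacts E) := subset_union_left
  have hQD₁ : edist (D₁ ⊔ Q) D₁ ≤ ENNReal.ofReal (r j) :=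
    edist_sup_le fun x hx => ⟨p, hpD, hQp hx⟩
  refine ⟨D₁ ⊔ Q, hAcore _ ⟨⟨p, hsub hpD, hpT⟩, fun i => ?_⟩ ?_, ?_⟩
  · by_cases his : i ∈ s
    · exact .inr (h.isUpwardClosed i D₁ (hD₁ i his) _ hsub)
    · refine .inl (hitSet_mono subset_closure ?_)
      rcases lt_or_ge i j with hij | hij
      · exact isUpwardClosed_hitSet _ D₁ (hD₁gate i hij his) _ hsub
      · exact isUpwardClosed_hitSet _ Q (hQgate i hij) _ subset_union_right
  · exact disjoint_union_left.2 ⟨hD₁A, hQA⟩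
  · calc edist (D₁ ⊔ Q) D ≤ edist (D₁ ⊔ Q) D₁ + edist D₁ D := edist_triangle _ _ _
      _ < ENNReal.ofReal (r j) + ENNReal.ofReal (r j) :=
        ENNReal.add_lt_add_of_le_of_lt (hQD₁.trans_lt ENNReal.ofReal_lt_top).ne hQD₁ hD₁D
      _ = ENNReal.ofReal (2 * r j) := by
        rw [← ENNReal.ofReal_add (h.pos j).le (h.pos j).le, two_mul]

theorem avoidingCore_gated_nonempty (h : IsGateSystem I T 𝒟 𝒩 net r) :
    (avoidingCore I (gated T 𝒟 net r)).Nonempty := by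
  obtain ⟨A, hA, hAcore⟩ :=
    exists_forall_disjoint_mem_avoidingCore h.ideal_nonempty (constrained T 𝒟 ∅)
  obtain ⟨x, hxT, hxA⟩ := not_subset.1 fun hTA => h.not_isCountablyCovered (hA.mono hTA)
  have hx : ({x} : Compacts E) ∈ avoidingCore I (constrained T 𝒟 ∅) :=
    hAcore _ ⟨⟨x, rfl, hxT⟩, by simp⟩ (by simpa)
  obtain ⟨D, hD, -⟩ := h.exists_mem_avoidingCore_gated (j := 0) hx (by simp)
  exact ⟨D, hD⟩

theorem exists_superset_eventually_disjoint_or_mem_hitSet_gate (h : IsGateSystem I T 𝒟 𝒩 net r)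
    (j : ℕ) {O : Set (Compacts E)} (hO : IsOpen O) {D : Compacts E}
    (hD : D ∈ avoidingCore I (gated T 𝒟 net r)) (hDO : D ∈ O) :
    ∃ s : Finset ℕ, ∃ D' ∈ avoidingCore I (gated T 𝒟 net r), D' ∈ O ∧ D ≤ D' ∧
      (∀ᶠ K : Compacts E in 𝓝 D', ∀ i ∈ s, Disjoint (K : Set E) (closure (gate net r i))) ∧
        ∀ i < j, i ∉ s → D' ∈ hitSet (gate net r i) := by
  classical
  let s : Finset ℕ := {i ∈ Finset.range j | Disjoint (D : Set E) (closure (gate net r i))}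
  have hs : IsOpen {D' : Compacts E | ∀ i ∈ s, Disjoint (D' : Set E) (closure (gate net r i))} := by
    simp only [ofPred_forall]
    exact isOpen_biInter_finset fun i _ => isOpen_setOfPred_disjoint isClosed_closure
  obtain ⟨D', ⟨hD'O, hD's⟩, hDD', hD'gate⟩ := exists_superset_mem_forall_mem_hitSet
    (hO.inter hs) ⟨hDO, fun i hi => (Finset.mem_filter.1 hi).2⟩ (Finset.range j \ s) fun i hi => by
      obtain ⟨hij, his⟩ := Finset.mem_sdiff.1 hi
      exact not_not.1 fun h => his (Finset.mem_filter.2 ⟨hij, notMem_hitSet_iff.1 h⟩)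
  refine ⟨s, D', h.isUpwardClosed_avoidingCore_gated D hD D' hDD', hD'O, hDD', hs.mem_nhds hD's, ?_⟩
  exact fun i hij his => hD'gate i (Finset.mem_sdiff.2 ⟨Finset.mem_range.2 hij, his⟩)

theorem exists_mem_stageWitnesses (h : IsGateSystem I T 𝒟 𝒩 net r) {j : ℕ} {D : Compacts E}
    (hD : D ∈ avoidingCore I (gated T 𝒟 net r)) (hDN : D ∈ 𝒩 j)
    (hj : ∀ A, IsCountablyCovered I A → ∃ D' ∈ 𝒟 j, D' ≤ D ∧ Disjoint (D' : Set E) A) :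
    ∃ D' ∈ 𝒩 j ∩ stageWitnesses I T 𝒟 net r j, Disjoint (D' : Set E) (net (r j)) := by
  obtain ⟨s, D₀, hD₀, hD₀N, hDD₀, hD₀s, hD₀gate⟩ :=
    h.exists_superset_eventually_disjoint_or_mem_hitSet_gate j (h.isOpen j) hD hDN
  obtain ⟨B, hB, hBcore⟩ :=
    exists_forall_disjoint_mem_avoidingCore h.ideal_nonempty (constrained T 𝒟 (insert j s))
  have hA := hB.union (h.isCountablyCovered_net _ (h.pos j))
  obtain ⟨D₂, hD₂, hD₂D, hD₂A⟩ := hj _ hA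
  have hcont : Continuous fun K : Compacts E => K ⊔ D₂ := continuous_id.sup continuous_const
  have hD₀D₂ : D₀ ⊔ D₂ = D₀ := sup_eq_left.2 (hD₂D.trans hDD₀)
  have hD₀N' : ∀ᶠ K in 𝓝 D₀, K ⊔ D₂ ∈ 𝒩 j :=
    ((h.isOpen j).preimage hcont).eventually_mem (by rwa [mem_preimage, hD₀D₂])
  obtain ⟨D₁, ⟨hD₁N, hD₁s, hD₁gate⟩, hD₁, hD₁A⟩ := mem_closure_iff_nhds.1 (hD₀ _ hA) _
    (hD₀N'.and (hD₀s.and (eventually_forall_mem_hitSet_gate hD₀gate)))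
  have hsub : (D₁ : Set E) ⊆ (D₁ ⊔ D₂ : Compacts E) := subset_union_left
  have hdisj := disjoint_union_right.1 (disjoint_union_left.2 ⟨hD₁A, hD₂A⟩)
  have hcon : D₁ ⊔ D₂ ∈ constrained T 𝒟 (insert j s) := by
    refine ⟨isUpwardClosed_hitSet T D₁ hD₁.1 _ hsub, Finset.forall_mem_insert _ _ _ |>.2 ⟨?_, ?_⟩⟩
    · exact h.isUpwardClosed j D₂ hD₂ _ subset_union_right
    · intro i hi
      have := (hD₁.2 i).resolve_left (notMem_hitSet_iff.2 (hD₁s i hi))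
      exact h.isUpwardClosed i D₁ this _ hsub
  refine ⟨D₁ ⊔ D₂, ⟨hD₁N, s, hBcore _ hcon hdisj.1, fun i hij his => ?_⟩, hdisj.2⟩
  exact isUpwardClosed_hitSet _ D₁ (hD₁gate i hij his) _ hsub

theorem exists_mem_avoidingCore_gated_disjoint (h : IsGateSystem I T 𝒟 𝒩 net r) {j : ℕ}
    (hj : ∃ D ∈ 𝒩 j ∩ stageWitnesses I T 𝒟 net r j, Disjoint (D : Set E) (net (r j))) :
    ∃ D ∈ 𝒩 j, ∃ D' ∈ avoidingCore I (gated T 𝒟 net r),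
      edist D' D < ENNReal.ofReal (2 * r (j + 1)) ∧
        Disjoint (D' : Set E) (closure (gate net r j)) := by
  obtain ⟨D, ⟨hDN, s, hD, hDs⟩, hDnet⟩ := h.isAdapted j hj
  obtain ⟨D', hD', hD'D⟩ := h.exists_mem_avoidingCore_gated (j := j + 1) hD fun i hi his => by
    rw [Finset.mem_insert, not_or] at his
    exact hDs i (by omega) his.2
  refine ⟨D, hDN, D', hD', hD'D, disjoint_left.2 fun x hxD' hxg => ?_⟩
  obtain ⟨y, hyD, hxy⟩ := Metric.mem_thickening_iff.1 (subset_thickening_of_edist_lt hD'D hxD')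
  refine disjoint_left.1 hDnet hyD ?_
  have hy : y ∈ Metric.thickening (2 * r (j + 1)) (gate net r j) := by
    rw [← Metric.thickening_closure]
    exact Metric.mem_thickening_iff.2 ⟨x, hxg, by rwa [dist_comm]⟩
  have hsub := Metric.thickening_thickening_subset (2 * r (j + 1)) (r (j + 1)) (net (r j)) hy
  rwa [show 2 * r (j + 1) + r (j + 1) = 3 * r (j + 1) by ring] at hsub

theorem exists_mem_avoidingCore_gated_mem_nhdsWithin (h : IsGateSystem I T 𝒟 𝒩 net r) {j : ℕ}
    {D : Compacts E} (hD : D ∈ avoidingCore I (gated T 𝒟 net r)) (hDN : D ∈ 𝒩 j)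
    (hj : ∀ A, IsCountablyCovered I A → ∃ D' ∈ 𝒟 j, D' ≤ D ∧ Disjoint (D' : Set E) A) :
    ∃ D₁ ∈ 𝒩 j, ∃ D' ∈ avoidingCore I (gated T 𝒟 net r),
      edist D' D₁ < ENNReal.ofReal (2 * r (j + 1)) ∧
        𝒟 j ∈ 𝓝[avoidingCore I (gated T 𝒟 net r)] D' := by
  obtain ⟨D₁, hD₁, D', hD', hD'D₁, hdisj⟩ :=
    h.exists_mem_avoidingCore_gated_disjoint (h.exists_mem_stageWitnesses hD hDN hj)
  refine ⟨D₁, hD₁, D', hD', hD'D₁, mem_nhdsWithin.2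
    ⟨_, isOpen_setOfPred_disjoint isClosed_closure, hdisj, fun D₂ hD₂ => ?_⟩⟩
  have hgated :=
    avoidingCore_subset h.ideal_nonempty (isClosed_gated h.isClosed_base h.isClosed) hD₂.2
  exact (hgated.2 j).resolve_left (notMem_hitSet_iff.2 hD₂.1)

theorem mem_closure_setOfPred_mem_nhdsWithin (h : IsGateSystem I T 𝒟 𝒩 net r)
    {𝒢 : Set (Compacts E)}
    (hfreq : ∀ N ∈ countableBasis (Compacts E), ∀ k, ∃ j ≥ k, 𝒟 j = 𝒢 ∧ 𝒩 j = N)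
    {D : Compacts E} (hD : D ∈ avoidingCore I (gated T 𝒟 net r))
    (h𝒢 : ∀ A, IsCountablyCovered I A → ∃ D' ∈ 𝒢, D' ≤ D ∧ Disjoint (D' : Set E) A) :
    D ∈ closure {D' ∈ avoidingCore I (gated T 𝒟 net r) |
      𝒢 ∈ 𝓝[avoidingCore I (gated T 𝒟 net r)] D'} := by
  rw [mem_closure_iff_nhds]
  intro O hO
  obtain ⟨δ, hδ, hδO⟩ := exists_eball_subset_of_mem_nhds hO
  have hδ2 : 0 < ENNReal.ofReal (δ / 2) := ENNReal.ofReal_pos.2 (half_pos hδ)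
  obtain ⟨N, hN, hDN, hND⟩ := (isBasis_countableBasis (Compacts E)).exists_subset_of_mem_open
    (Metric.mem_eball_self hδ2) Metric.isOpen_eball
  obtain ⟨k, hk⟩ := (h.tendsto.eventually_lt_const (show 0 < δ / 4 by positivity)).exists
  obtain ⟨j, hkj, rfl, rfl⟩ := hfreq N hN k
  obtain ⟨D₁, hD₁, D', hD', hD'D₁, hhit⟩ :=
    h.exists_mem_avoidingCore_gated_mem_nhdsWithin hD hDN h𝒢
  have hr : 2 * r (j + 1) ≤ δ / 2 := by linarith [h.antitone (show k ≤ j + 1 by omega)]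
  have hsum : ENNReal.ofReal (δ / 2) + ENNReal.ofReal (δ / 2) = ENNReal.ofReal δ := by
    rw [← ENNReal.ofReal_add (by positivity) (by positivity), add_halves]
  exact ⟨D', hδO (((edist_triangle D' D₁ D).trans_lt (ENNReal.add_lt_add
    (hD'D₁.trans_le (ENNReal.ofReal_le_ofReal hr)) (hND hD₁))).trans_eq hsum), hD', hhit⟩

end IsGateSystem

/-- `𝓕` represents `I`: among the `G_δ` sets `G`, those covered by countably many members of `I` are
the ones for which `G*` is meager in `𝓕`. -/
def Represents {E : Type*} [TopologicalSpace E] (𝓕 I : Set (Compacts E)) : Prop :=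
  ∀ G : Set E, IsGδ G → (IsCountablyCovered I G ↔ IsMeagerIn (hitSet G) 𝓕)

/-- The closure of the set of points `x` with `{x} ∈ I`. -/
def pointClosure {E : Type*} [TopologicalSpace E] (I : Set (Compacts E)) : Set E :=
  closure {x | {x} ∈ I}

section PointClosure

variable {E : Type*} [MetricSpace E] [CompactSpace E] {I : Set (Compacts E)}

theorem exists_finite_net_pointClosure (hI : I.Nonempty) {ε : ℝ} (hε : 0 < ε) :
    ∃ s : Set E, s.Finite ∧ IsCountablyCovered I s ∧
      ∀ x ∈ pointClosure I, ∃ a ∈ s, dist x a < ε := by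
  obtain ⟨s, hsI, hs, hcov⟩ := Metric.finite_approx_of_totallyBounded
    (isCompact_univ.totallyBounded.subset (subset_univ {x : E | ({x} : Compacts E) ∈ I}))
    (ε / 2) (half_pos hε)
  refine ⟨s, hs, ?_, fun x hx => ?_⟩
  · rw [← biUnion_of_singleton s]
    exact isCountablyCovered_biUnion hI hs.countable fun x hx =>
      Compacts.coe_singleton x ▸ isCountablyCovered_of_mem (hsI hx)
  · obtain ⟨y, hy, hxy⟩ := Metric.mem_closure_iff.1 hx (ε / 2) (half_pos hε)
    obtain ⟨a, ha, hya⟩ := mem_iUnion₂.1 (hcov hy)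
    refine ⟨a, ha, (dist_triangle x y a).trans_lt ?_⟩
    rw [Metric.mem_ball] at hya
    linarith

theorem exists_isGateSystem (hmeagre : ∀ K ∈ I, IsMeagre (K : Set E)) (hI : I.Nonempty)
    (hT : ¬ IsCountablyCovered I (pointClosure I)) {𝔾 : Set (Set (Compacts E))}
    (h𝔾 : 𝔾.Countable) (hclosed : ∀ 𝒢 ∈ 𝔾, IsClosed 𝒢) (hup : ∀ 𝒢 ∈ 𝔾, IsUpwardClosed 𝒢) :
    ∃ 𝒟 𝒩 net r, IsGateSystem I (pointClosure I) 𝒟 𝒩 net r ∧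
      ∀ 𝒢 ∈ 𝔾, ∀ N ∈ countableBasis (Compacts E), ∀ k, ∃ j ≥ k, 𝒟 j = 𝒢 ∧ 𝒩 j = N := by
  have : Countable ↥(insert univ 𝔾) := (h𝔾.insert univ).to_subtype
  have : Countable ↥(insert univ (countableBasis (Compacts E))) :=
    ((countable_countableBasis _).insert univ).to_subtype
  obtain ⟨e, he⟩ := exists_seq_frequently_eq
    (↥(insert univ 𝔾) × ↥(insert univ (countableBasis (Compacts E))))
  choose! net hfin hcov hdist using fun ε => exists_finite_net_pointClosure hI (ε := ε)
  let 𝒟 : ℕ → Set (Compacts E) := fun j => (e j).1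
  let 𝒩 : ℕ → Set (Compacts E) := fun j => (e j).2
  obtain ⟨r, hr, hstep⟩ := exists_forall_isAdapted I (pointClosure I) 𝒟 𝒩
    fun ε hε => (hfin ε hε).isCompact
  refine ⟨𝒟, 𝒩, net, r, ?_, fun 𝒢 h𝒢 N hN k => ?_⟩
  · exact
    { isMeagre := hmeagre
      isClosed_base := isClosed_closure
      not_isCountablyCovered := hT
      isClosed := fun j => forall_mem_insert.2 ⟨isClosed_univ, hclosed⟩ _ (e j).1.2
      isUpwardClosed := fun j =>
        forall_mem_insert.2 ⟨fun _ _ _ _ => mem_univ _, hup⟩ _ (e j).1.2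
      isOpen := fun j => forall_mem_insert.2
        ⟨isOpen_univ, fun _ => isOpen_of_mem_countableBasis⟩ _ (e j).2.2
      isCountablyCovered_net := hcov
      exists_dist_net_lt := hdist
      pos := hr
      le_half := fun j => (hstep j).1
      isAdapted := fun j => (hstep j).2 }
  · obtain ⟨j, hj, hej⟩ := he (⟨𝒢, .inr h𝒢⟩, ⟨N, .inr hN⟩) k
    exact ⟨j, hj, by simp [𝒟, 𝒩, hej]⟩

theorem exists_represents_of_not_isCountablyCovered_pointClosure
    (hmeagre : ∀ K ∈ I, IsMeagre (K : Set E)) (hI : I.Nonempty) (havoid : IsSigmaAvoidable I Iᶜ)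
    (hT : ¬ IsCountablyCovered I (pointClosure I)) :
    ∃ 𝓕, IsCompact 𝓕 ∧ IsUpwardClosed 𝓕 ∧ Represents 𝓕 I := by
  obtain ⟨𝒞, h𝒞, hav, hsub⟩ := havoid
  let 𝔾 := image2 (fun C V => transversals {M ∈ C | (M : Set E) ⊆ closure V}) 𝒞 (countableBasis E)
  obtain ⟨𝒟, 𝒩, net, r, h, hfreq⟩ := exists_isGateSystem hmeagre hI hT (𝔾 := 𝔾)
    (h𝒞.image2 (countable_countableBasis E) _)
    (forall_mem_image2.2 fun _ _ _ _ => isClosed_transversals _)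
    (forall_mem_image2.2 fun _ _ _ _ => isUpwardClosed_transversals _)
  let 𝓕 := avoidingCore I (gated (pointClosure I) 𝒟 net r)
  have h𝓕 : IsUpwardClosed 𝓕 := h.isUpwardClosed_avoidingCore_gated
  refine ⟨𝓕, isClosed_avoidingCore.isCompact, h𝓕, fun G hG => ⟨fun hcov => ?_, fun hmeag => ?_⟩⟩
  · exact hcov.isMeagerIn_hitSet fun K hK => isMeagerIn_hitSet_avoidingCore hK
  by_contra hcov
  obtain ⟨G', hG'G, hG', hne, hloc⟩ := exists_isGδ_locally_not_isCountablyCovered hI hG hcov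
  refine h𝓕.not_isMeagerIn_hitSet isClosed_avoidingCore h.avoidingCore_gated_nonempty hG' hne
    ?_ (hmeag.mono (hitSet_mono hG'G))
  rintro D hD V hV hVD ⟨x, hxG, hxV⟩
  obtain ⟨B, hB, hxB, hBV⟩ := (isBasis_countableBasis E).exists_subset_of_mem_open hxV hV
  let M : Compacts E := ⟨closure (G' ∩ B), isClosed_closure.isCompact⟩
  have hM : M ∉ I := fun hMI => hloc B (isOpen_of_mem_countableBasis hB) ⟨x, hxG, hxB⟩
    ((isCountablyCovered_of_mem hMI).mono subset_closure)
  obtain ⟨C, hC, hMC⟩ := hsub hM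
  refine closure_mono ?_ (h.mem_closure_setOfPred_mem_nhdsWithin
    (hfreq _ (mem_image2_of_mem hC hB)) hD fun A hA => ?_)
  · refine fun D' hD' => ⟨hD'.1, mem_of_superset hD'.2 fun D'' hD'' => ?_⟩
    exact hitSet_mono (closure_mono (inter_subset_inter_right _ hBV))
      (hD'' M ⟨hMC, closure_mono inter_subset_right⟩)
  · obtain ⟨D', hD', hD'B, hdisj⟩ := (hav C hC).exists_mem_transversals_sep isClosed_closure hA
    exact ⟨D', hD', hD'B.trans ((closure_mono hBV).trans hVD), hdisj⟩

end PointClosure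

section Refinement

variable {X ι : Type*} [TopologicalSpace X] {T : Set X} {u : ι → Set X}

theorem LocallyFiniteOff.comp_injective {κ : Type*} {g : κ → ι} (hu : LocallyFiniteOff T u)
    (hg : Function.Injective g) : LocallyFiniteOff T fun b => u (g b) := fun x hx =>
  let ⟨O, hO, hfin⟩ := hu x hx
  ⟨O, hO, Set.Finite.preimage (s := {a | (u a ∩ O).Nonempty}) hg.injOn hfin⟩

theorem LocallyFiniteOff.exists_disjoint_refinement (hu : LocallyFiniteOff T u) (hT : IsClosed T)
    (hopen : ∀ a, IsOpen (u a)) (hcov : Tᶜ ⊆ ⋃ a, u a) :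
    ∃ v : ι → Set X, (∀ a, IsOpen (v a)) ∧ (∀ a, v a ⊆ u a) ∧
      Pairwise (Function.onFun Disjoint v) ∧ Tᶜ ⊆ _root_.closure (⋃ a, v a) := by
  let v : ι → Set X := fun a => u a \ (T ∪ ⋃ b : {b // WellOrderingRel b a}, _root_.closure (u b))
  have hdisj : ∀ a b, WellOrderingRel b a → Disjoint (v a) (v b) := fun a b hba =>
    disjoint_left.2 fun x hxa hxb => hxa.2 (.inr (mem_iUnion.2 ⟨⟨b, hba⟩, subset_closure hxb.1⟩))
  refine ⟨v, fun a => (hopen a).sdiff ?_, fun a => sdiff_subset, fun a b hab => ?_, fun x hx => ?_⟩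
  · exact (hu.closure.comp_injective Subtype.val_injective).isClosed_union_iUnion hT
      fun _ => isClosed_closure
  · rcases trichotomous_of WellOrderingRel a b with h | h | h
    exacts [(hdisj b a h).symm, (hab h).elim, hdisj a b h]
  · refine mem_closure_iff.2 fun Q hQ hxQ => ?_
    have hQT : IsOpen (Q \ T) := hQ.sdiff hT
    have hne : {a | (Q \ T ∩ u a).Nonempty}.Nonempty := by
      obtain ⟨a, ha⟩ := mem_iUnion.1 (hcov hx)
      exact ⟨a, x, ⟨hxQ, hx⟩, ha⟩
    have hwf : WellFounded (WellOrderingRel (α := ι)) := IsWellFounded.wf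
    obtain ⟨y, hyQ, hy⟩ := hwf.min_mem _ hne
    refine ⟨y, hyQ.1, mem_iUnion.2 ⟨hwf.min _ hne, hy, ?_⟩⟩
    rintro (hyT | hyu)
    · exact hyQ.2 hyT
    · obtain ⟨b, hb⟩ := mem_iUnion.1 hyu
      exact hwf.not_lt_min _ (mem_closure_iff.1 hb _ hQT hyQ) b.2

theorem LocallyFiniteOff.setOfPred_superset (hu : LocallyFiniteOff T u)
    (hne : ∀ a, (u a).Nonempty) :
    LocallyFiniteOff (hitSet T) fun a => {D : Compacts X | u a ⊆ D} := by
  intro D hD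
  obtain ⟨O, hO, hDO, hfin⟩ := hu.exists_isOpen_superset D.isCompact (notMem_hitSet_iff.1 hD)
  refine ⟨{D' | (D' : Set X) ⊆ O}, (Compacts.isOpen_subsets_of_isOpen hO).mem_nhds hDO,
    hfin.subset ?_⟩
  rintro a ⟨D', haD', hD'O⟩
  exact (hne a).mono fun x hx => ⟨hx, hD'O (haD' hx)⟩

end Refinement

/-- `u` is a family of disjoint nonempty open sets, with union dense outside `T`, that is locally
finite outside `T` and whose members shrink as they approach `T`. -/
structure IsCellFamily {E ι : Type*} [MetricSpace E] (T : Set E) (u : ι → Set E) : Prop where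
  isOpen : ∀ a, IsOpen (u a)
  nonempty : ∀ a, (u a).Nonempty
  pairwise_disjoint : Pairwise (Function.onFun Disjoint u)
  locallyFiniteOff : LocallyFiniteOff T u
  compl_subset_closure : Tᶜ ⊆ closure (⋃ a, u a)
  disjoint_closure : ∀ a, Disjoint (closure (u a)) T
  subset_closedBall : ∀ a, ∀ x ∈ u a, ∀ y ∈ T, u a ⊆ Metric.closedBall y (3 * dist x y)

section CellFamily

universe v

variable {E : Type v} [MetricSpace E] {T : Set E}

theorem exists_locallyFiniteOff_ball_cover [CompactSpace E] (hT : IsClosed T) :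
    ∃ (ι : Type v) (c : ι → E) (ρ : ι → ℝ),
      LocallyFiniteOff T (fun a => Metric.ball (c a) (ρ a)) ∧
        (Tᶜ ⊆ ⋃ a, Metric.ball (c a) (ρ a)) ∧ ∀ a, ∀ y ∈ T, 2 * ρ a < dist (c a) y := by
  have : LocallyCompactSpace ↥Tᶜ := hT.isOpen_compl.locallyCompactSpace
  have hbasis : ∀ x : ↥Tᶜ, (𝓝 x).HasBasis
      (fun ρ : ℝ => 0 < ρ ∧ ∀ y ∈ T, 2 * ρ < dist (x : E) y) (Metric.ball x) := by
    intro x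
    refine Metric.nhds_basis_ball.restrict fun ρ hρ => ?_
    obtain ⟨R, hR, hRT⟩ := Metric.isOpen_iff.1 hT.isOpen_compl x x.2
    refine ⟨min ρ (R / 3), lt_min hρ (by positivity), fun y hy => ?_,
      Metric.ball_subset_ball (min_le_left _ _)⟩
    have hRy : R ≤ dist (x : E) y := by
      by_contra! hlt
      exact hRT (Metric.mem_ball'.2 hlt) hy
    linarith [min_le_right ρ (R / 3)]
  obtain ⟨ι, c, ρ, hρ, hcov, hfin⟩ :=
    refinement_of_locallyCompact_sigmaCompact_of_nhds_basis hbasis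
  refine ⟨ι, fun a => c a, ρ, fun x hx => ?_, fun x hx => ?_, fun a => (hρ a).2⟩
  · obtain ⟨Q, hQ, hQfin⟩ := hfin ⟨x, hx⟩
    refine ⟨(↑) '' Q, hT.isOpen_compl.isOpenEmbedding_subtypeVal.isOpenMap.image_mem_nhds hQ,
      hQfin.subset ?_⟩
    rintro a ⟨_, hy, y, hyQ, rfl⟩
    exact ⟨y, hy, hyQ⟩
  · obtain ⟨a, ha⟩ := mem_iUnion.1 (hcov.symm ▸ mem_univ (⟨x, hx⟩ : ↥Tᶜ))
    exact mem_iUnion.2 ⟨a, ha⟩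

theorem exists_isCellFamily [CompactSpace E] (hT : IsClosed T) :
    ∃ (ι : Type v) (u : ι → Set E), IsCellFamily T u := by
  obtain ⟨ι, c, ρ, hfin, hcov, hρ⟩ := exists_locallyFiniteOff_ball_cover hT
  obtain ⟨u, hopen, hball, hdisj, hdense⟩ :=
    hfin.exists_disjoint_refinement hT (fun a => Metric.isOpen_ball) hcov
  refine ⟨{a // (u a).Nonempty}, fun a => u a, fun a => hopen a, fun a => a.2,
    fun a b hab => hdisj (Subtype.val_injective.ne hab),
    (hfin.mono hball).comp_injective Subtype.val_injective, ?_, fun a => ?_, ?_⟩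
  · refine hdense.trans (closure_mono (iUnion_subset fun a x hx => ?_))
    exact mem_iUnion.2 ⟨⟨a, x, hx⟩, hx⟩
  · refine disjoint_left.2 fun x hx hxT => ?_
    have hxc : x ∈ Metric.closedBall (c a) (ρ a) :=
      closure_minimal ((hball a).trans Metric.ball_subset_closedBall) Metric.isClosed_closedBall hx
    rw [Metric.mem_closedBall'] at hxc
    linarith [hρ a x hxT, dist_nonneg (x := c a) (y := x)]
  · intro a x hx y hy z hz
    have hxc := Metric.mem_ball'.1 (hball a hx)
    have hzc := Metric.mem_ball.1 (hball a hz)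
    rw [Metric.mem_closedBall]
    linarith [hρ a y hy, dist_triangle (c a) x y, dist_triangle z (c a) y]

end CellFamily

/-- The compact sets that intersect `T` or contain one of the sets `u a`. -/
def hitOrContain {E ι : Type*} [TopologicalSpace E] (T : Set E) (u : ι → Set E) :
    Set (Compacts E) :=
  hitSet T ∪ ⋃ a, {D | u a ⊆ D}

theorem isUpwardClosed_hitOrContain {E ι : Type*} [TopologicalSpace E] (T : Set E)
    (u : ι → Set E) : IsUpwardClosed (hitOrContain T u) := by
  rintro D (hD | hD) D' hDD'
  · exact .inl (isUpwardClosed_hitSet T D hD D' hDD')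
  · obtain ⟨a, ha⟩ := mem_iUnion.1 hD
    exact .inr (mem_iUnion.2 ⟨a, ha.trans hDD'⟩)

namespace IsCellFamily

variable {E ι : Type*} [MetricSpace E] {T : Set E} {u : ι → Set E}

theorem isClosed_hitOrContain (hu : IsCellFamily T u) (hT : IsClosed T) :
    IsClosed (hitOrContain T u) :=
  (hu.locallyFiniteOff.setOfPred_superset hu.nonempty).isClosed_union_iUnion (isClosed_hitSet hT)
    fun a => isClosed_setOfPred_superset (u a)

theorem exists_subset_closedBall (hu : IsCellFamily T u) (hd : Dense Tᶜ) {y : E} (hy : y ∈ T)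
    {ε : ℝ} (hε : 0 < ε) : ∃ a, closure (u a) ⊆ Metric.closedBall y ε := by
  obtain ⟨x, hx, hyx⟩ := Metric.mem_closure_iff.1
    (closure_minimal hu.compl_subset_closure isClosed_closure (hd y)) (ε / 3) (by positivity)
  obtain ⟨a, hxa⟩ := mem_iUnion.1 hx
  refine ⟨a, closure_minimal ((hu.subset_closedBall a x hxa y hy).trans
    (Metric.closedBall_subset_closedBall ?_)) Metric.isClosed_closedBall⟩
  rw [dist_comm]
  linarith

variable [CompactSpace E]

theorem isMeagerIn_hitSet (hu : IsCellFamily T u) (hT : IsClosed T) (hd : Dense Tᶜ) :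
    IsMeagerIn (hitSet T) (hitOrContain T u) := by
  refine isMeagerIn_of_isClosed_of_subset_closure (isClosed_hitSet hT) fun D hD => ?_
  by_cases hDT : D ∈ hitSet T
  · obtain ⟨y, hyD, hyT⟩ := hDT
    refine mem_closure_iff_nhds.2 fun N hN => ?_
    obtain ⟨ε, hε, hball⟩ := exists_forall_sup_mem_of_mem_nhds hN hyD
    obtain ⟨D', hD'N, -, hD'T⟩ :=
      mem_closure_iff_nhds.1 (mem_closure_finite_subset_of_dense hd D) _ hball
    obtain ⟨a, ha⟩ := hu.exists_subset_closedBall hd hyT hε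
    let Q : Compacts E := ⟨closure (u a), isClosed_closure.isCompact⟩
    refine ⟨D' ⊔ Q, hD'N Q ha, .inr (mem_iUnion.2 ⟨a, subset_closure.trans subset_union_right⟩),
      notMem_hitSet_iff.2 (disjoint_union_left.2 ⟨?_, hu.disjoint_closure a⟩)⟩
    exact subset_compl_iff_disjoint_right.1 hD'T
  · exact subset_closure ⟨hD, hDT⟩

theorem exists_isOpen_forall_closure_subset (hu : IsCellFamily T u) (hT : IsClosed T) (a : ι) :
    ∃ O, IsOpen O ∧ (hitOrContain T u ∩ O).Nonempty ∧
      ∀ D ∈ hitOrContain T u ∩ O, closure (u a) ⊆ (D : Set E) := by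
  choose p hp using hu.nonempty
  let S : Set E := T ∪ ⋃ b : {b // b ≠ a}, {p b}
  have hS : IsClosed S := ((hu.locallyFiniteOff.mono fun b => singleton_subset_iff.2 (hp b))
    |>.comp_injective Subtype.val_injective).isClosed_union_iUnion hT fun _ => isClosed_singleton
  let Q : Compacts E := ⟨closure (u a), isClosed_closure.isCompact⟩
  refine ⟨_, isOpen_setOfPred_disjoint hS, ⟨Q, .inr (mem_iUnion.2 ⟨a, subset_closure⟩), ?_⟩, ?_⟩
  · refine disjoint_union_right.2 ⟨hu.disjoint_closure a, disjoint_iUnion_right.2 fun b => ?_⟩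
    exact ((hu.pairwise_disjoint b.2.symm).closure_left (hu.isOpen b)).mono_right
      (singleton_subset_iff.2 (hp b))
  · rintro D ⟨hDT | hDu, hDS⟩
    · exact (notMem_hitSet_iff.2 (disjoint_union_right.1 hDS).1 hDT).elim
    · obtain ⟨b, hb⟩ := mem_iUnion.1 hDu
      suffices b = a from this ▸ closure_minimal hb D.isCompact.isClosed
      by_contra hba
      exact disjoint_left.1 hDS (hb (hp b)) (.inr (mem_iUnion.2 ⟨⟨b, hba⟩, rfl⟩))

theorem isMeagerIn_hitSet_iff (hu : IsCellFamily T u) (hT : IsClosed T) (hd : Dense Tᶜ)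
    {G : Set E} : IsMeagerIn (hitSet G) (hitOrContain T u) ↔ G ⊆ T := by
  refine ⟨fun hmeagre x hxG => ?_, fun hGT => (hu.isMeagerIn_hitSet hT hd).mono (hitSet_mono hGT)⟩
  by_contra hxT
  obtain ⟨a, hxa⟩ := mem_iUnion.1 ((hu.locallyFiniteOff.closure_iUnion_subset hT
    (hu.compl_subset_closure hxT)).resolve_left hxT)
  obtain ⟨O, hO, ⟨D, hD, hDO⟩, hOa⟩ := hu.exists_isOpen_forall_closure_subset hT a
  have : CompactSpace (hitOrContain T u) :=
    isCompact_iff_compactSpace.1 (hu.isClosed_hitOrContain hT).isCompact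
  refine not_isMeagre_of_isOpen (hO.preimage continuous_subtype_val) ⟨⟨D, hD⟩, hDO⟩
    (IsMeagre.mono ?_ hmeagre)
  exact fun D' hD' => ⟨x, hOa D' ⟨D'.2, hD'⟩ hxa, hxG⟩

end IsCellFamily

theorem exists_represents_of_isCountablyCovered_pointClosure {E : Type*} [MetricSpace E]
    [CompactSpace E] {I : Set (Compacts E)} (hstar : HasPropertyStar I)
    (hmeagre : ∀ K ∈ I, IsMeagre (K : Set E)) (hT : IsCountablyCovered I (pointClosure I)) :
    ∃ 𝓕, IsCompact 𝓕 ∧ IsUpwardClosed 𝓕 ∧ Represents 𝓕 I := by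
  obtain ⟨ι, u, hu⟩ := exists_isCellFamily (T := pointClosure I) isClosed_closure
  refine ⟨hitOrContain (pointClosure I) u, (hu.isClosed_hitOrContain isClosed_closure).isCompact,
    isUpwardClosed_hitOrContain _ u, fun G _ => ?_⟩
  rw [hu.isMeagerIn_hitSet_iff isClosed_closure (hT.dense_compl hmeagre)]
  refine ⟨?_, hT.mono⟩
  rintro ⟨K, hK, hGK⟩ x hx
  obtain ⟨n, hn⟩ := mem_iUnion.1 (hGK hx)
  refine subset_closure (hstar.mem_of_subset (hK n) ?_)
  rwa [Compacts.coe_singleton, singleton_subset_iff]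

section ClosedEmbedding

variable {X E : Type*} [TopologicalSpace X] [TopologicalSpace E] {I : Set (Compacts E)} {φ : X → E}

theorem HasPropertyStar.preimage_map (hstar : HasPropertyStar I) (hφ : Continuous φ) :
    HasPropertyStar (Compacts.map φ hφ ⁻¹' I) := by
  intro K hK
  obtain ⟨G, hG, hKG, hGI⟩ := hstar (fun n => (K n).map φ hφ) hK
  refine ⟨φ ⁻¹' G, hG.preimage hφ, ?_, fun L hL => hGI _ (image_subset_iff.2 hL)⟩
  exact iUnion_subset fun n => image_subset_iff.1 ((subset_iUnion _ n).trans hKG)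

theorem HasPropertyStar.preimage_map_nonempty (hstar : HasPropertyStar I) (hI : I.Nonempty)
    (hφ : Continuous φ) :
    (Compacts.map φ hφ ⁻¹' I).Nonempty :=
  let ⟨_, hK⟩ := hI
  ⟨⊥, hstar.mem_of_subset hK (by simp)⟩

theorem preimage_map_hitSet (hφ : Continuous φ) (G : Set E) :
    Compacts.map φ hφ ⁻¹' hitSet G = hitSet (φ ⁻¹' G) :=
  ext fun _ => image_inter_nonempty_iff

theorem isCountablyCovered_preimage_map_iff (hstar : HasPropertyStar I) (hφ : IsClosedEmbedding φ)
    (hrange : IsCountablyCovered I (range φ)ᶜ) {G : Set E} :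
    IsCountablyCovered (Compacts.map φ hφ.continuous ⁻¹' I) (φ ⁻¹' G) ↔
      IsCountablyCovered I G := by
  constructor
  · rintro ⟨K, hK, hGK⟩
    have hcov : IsCountablyCovered I (⋃ n, φ '' (K n : Set X)) :=
      ⟨fun n => (K n).map φ hφ.continuous, hK, subset_rfl⟩
    refine (hrange.union hcov).mono fun x hx => ?_
    by_cases hxφ : x ∈ range φ
    · obtain ⟨y, rfl⟩ := hxφ
      rw [← image_iUnion]
      exact .inr (mem_image_of_mem φ (hGK hx))
    · exact .inl hxφ
  · rintro ⟨K, hK, hGK⟩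
    refine ⟨fun n => ⟨φ ⁻¹' K n, hφ.isCompact_preimage (K n).isCompact⟩,
      fun n => hstar.mem_of_subset (hK n) (image_preimage_subset _ _), ?_⟩
    exact (preimage_mono hGK).trans preimage_iUnion.subset

theorem isMeagre_of_mem_preimage_map [T2Space X] (hstar : HasPropertyStar I)
    (hφ : IsClosedEmbedding φ) (hrange : IsCountablyCovered I (range φ)ᶜ)
    (hmax : ∀ O, IsOpen O → IsCountablyCovered I O → O ⊆ (range φ)ᶜ) {K : Compacts X}
    (hK : K.map φ hφ.continuous ∈ I) : IsMeagre (K : Set X) := by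
  refine IsNowhereDense.isMeagre ?_
  rw [K.isCompact.isClosed.isNowhereDense_iff, eq_empty_iff_forall_notMem]
  intro x hx
  obtain ⟨O, hO, hOK⟩ := hφ.isInducing.isOpen_iff.1 (isOpen_interior (s := (K : Set X)))
  have hcov : IsCountablyCovered I O := by
    rw [← isCountablyCovered_preimage_map_iff hstar hφ hrange, hOK]
    exact (isCountablyCovered_of_mem (mem_preimage.2 hK)).mono interior_subset
  have hxO : x ∈ φ ⁻¹' O := hOK ▸ hx
  exact hmax O hO hcov hxO (mem_range_self x)

theorem Represents.image_map (hstar : HasPropertyStar I) (hφ : IsClosedEmbedding φ)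
    (hrange : IsCountablyCovered I (range φ)ᶜ) {𝓕 : Set (Compacts X)}
    (h𝓕 : Represents 𝓕 (Compacts.map φ hφ.continuous ⁻¹' I)) :
    Represents (Compacts.map φ hφ.continuous '' 𝓕) I := by
  intro G hG
  rw [← isCountablyCovered_preimage_map_iff hstar hφ hrange, h𝓕 _ (hG.preimage hφ.continuous),
    isMeagerIn_image_iff hφ.isEmbedding.compacts_map, preimage_map_hitSet]

end ClosedEmbedding

section Representation

variable {E : Type*} [TopologicalSpace E] [CompactSpace E] [PolishSpace E] {I : Set (Compacts E)}

theorem exists_isCompact_isUpwardClosed_represents (hI : I.Nonempty) (hGδ : IsGδ I)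
    (hstar : HasPropertyStar I) (hmeagre : ∀ K ∈ I, IsMeagre (K : Set E)) :
    ∃ 𝓕, IsCompact 𝓕 ∧ IsUpwardClosed 𝓕 ∧ Represents 𝓕 I := by
  let _ := metrizableSpaceMetric E
  by_cases hT : IsCountablyCovered I (pointClosure I)
  · exact exists_represents_of_isCountablyCovered_pointClosure hstar hmeagre hT
  · exact exists_represents_of_not_isCountablyCovered_pointClosure hmeagre hI
      (isSigmaAvoidable_compl hI hGδ hstar) hT

theorem exists_isCompact_represents (hI : I.Nonempty) (hGδ : IsGδ I) (hstar : HasPropertyStar I) :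
    ∃ 𝓕, IsCompact 𝓕 ∧ Represents 𝓕 I := by
  obtain ⟨U, hUo, hU, hmax⟩ := exists_isOpen_largest_isCountablyCovered_inter hI (univ : Set E)
  simp only [univ_inter] at hU hmax
  have hφ : IsClosedEmbedding ((↑) : ↥Uᶜ → E) := hUo.isClosed_compl.isClosedEmbedding_subtypeVal
  have : CompactSpace ↥Uᶜ := hφ.compactSpace
  have : PolishSpace ↥Uᶜ := hφ.polishSpace
  have hrange : (range ((↑) : ↥Uᶜ → E))ᶜ = U := by rw [Subtype.range_coe, compl_compl]
  rw [← hrange] at hU hmax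
  obtain ⟨𝓕, h𝓕c, -, h𝓕⟩ := exists_isCompact_isUpwardClosed_represents
    (hstar.preimage_map_nonempty hI hφ.continuous)
    (hGδ.preimage hφ.isEmbedding.compacts_map.continuous) (hstar.preimage_map hφ.continuous)
    fun K hK => isMeagre_of_mem_preimage_map hstar hφ hU hmax hK
  exact ⟨_, h𝓕c.image hφ.isEmbedding.compacts_map.continuous, h𝓕.image_map hstar hφ hU⟩

end Representation

theorem theorem1 {E : Type*} [TopologicalSpace E] [CompactSpace E] [PolishSpace E]
    (I : Set (Compacts E)) (hI : IsCompactIdeal I) (hGδ : IsGδ I) (hstar : HasPropertyStar I) :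
    (∃ 𝓕 : Set (Compacts E), IsCompact 𝓕 ∧
      ∀ G : Set E, IsGδ G → (IsCountablyCovered I G ↔ IsMeagerIn (hitSet G) 𝓕)) ∧
    ((∀ K ∈ I, IsMeagre (K : Set E)) →
      ∃ 𝓕 : Set (Compacts E), IsCompact 𝓕 ∧ IsUpwardClosed 𝓕 ∧
        ∀ G : Set E, IsGδ G → (IsCountablyCovered I G ↔ IsMeagerIn (hitSet G) 𝓕)) :=
  ⟨exists_isCompact_represents hI.nonempty hGδ hstar,
    exists_isCompact_isUpwardClosed_represents hI.nonempty hGδ hstar⟩
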